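/- Let $\Gamma$ be a finite, connected metric graph without loops (parallel edges allowed), with vertex set $\mathcal V$, edge set $\mathcal E$ and edge lengths $L(e)\in(0,\infty)$, where each edge $e$ is identified with the interval $[0,L(e)]$. Its standard Laplacian $-\Delta_\Gamma$ is the operator in $L^2(\Gamma)=\bigoplus_{e\in\mathcal E}L^2(0,L(e))$ (complex-valued functions) which acts as $(-\Delta_\Gamma f)_e=-f_e''$ on all $f$ with $f_e\in H^2(0,L(e))$ for each $e\in\mathcal E$ that are continuous at each vertex and satisfy the Kirchhoff condition, i.e. at each vertex $v$ the derivatives of $f$ at $v$ along all edges incident to $v$, taken in the direction towards $v$, sum up to zero. For $j=1,2,\dots$ let $\mu_j(\Gamma)$ denote the $j$-th eigenvalue of $-\Delta_\Gamma$, where the eigenvalues are ordered non-decreasingly and counted with multiplicities; that is, $\mu_j(\Gamma)$ is the least real $t$ such that $-\Delta_\Gamma$ has at least $j$ eigenvalues in $(-\infty,t]$, counted with multiplicities. Assume that $\Gamma$ has at least two edges. Let $e_0$ be a pendant edge of $\Gamma$, i.e. an edge one of whose endpoints, $v_1$, has degree one, let $v_0$ be the other endpoint of $e_0$, and let $\Gamma'$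 be the metric graph obtained from $\Gamma$ by removing $e_0$ together with $v_1$. Then, for each $k=1,2,\dots$, the eigenvalues $\mu_{k+1}(\Gamma)$ and $\mu_{k+1}(\Gamma')$ exist and $$\mu_{k+1}(\Gamma)\le\mu_{k+1}(\Gamma').$$ If $\mu_{k+1}(\Gamma)=\mu_{k+1}(\Gamma')$, then there exists an eigenfunction of $-\Delta_{\Gamma'}$ corresponding to the eigenvalue $\mu_{k+1}(\Gamma')$ which is zero at the vertex $v_0$. -/

import Mathlib

open MeasureTheory Set
open scoped ContDiff

noncomputable section

/-! ### Sobolev functions on a bounded interval -/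

/-- The complex Hilbert space `L²(0, ℓ)`. -/
abbrev IntervalL2 (ℓ : ℝ) : Type := Lp ℂ 2 (volume.restrict (Ioo (0 : ℝ) ℓ))

/-- `g` is the weak derivative of `f` on the open interval `(0, ℓ)`: for all test functions
`φ ∈ C_c^∞(0, ℓ)` one has `∫ φ' f = - ∫ φ g`. -/
def HasWeakDeriv {ℓ : ℝ} (f g : IntervalL2 ℓ) : Prop :=
  ∀ φ : ℝ → ℝ, ContDiff ℝ ∞ φ → HasCompactSupport φ → tsupport φ ⊆ Ioo 0 ℓ →
    ∫ x in Ioo 0 ℓ, deriv φ x • f x = - ∫ x in Ioo 0 ℓ, φ x • g x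

/-- `f ∈ L²(0, ℓ)` has a continuous representative on `[0, ℓ]`, whose boundary values (traces)
are `a` at `0` and `b` at `ℓ`. Every function in `H¹(0, ℓ)` has such a representative, and
for `0 < ℓ` the values `a` and `b` are determined by `f`. -/
def HasBoundaryValues {ℓ : ℝ} (f : IntervalL2 ℓ) (a b : ℂ) : Prop :=
  ∃ u : ℝ → ℂ, ContinuousOn u (Icc 0 ℓ) ∧ f =ᵐ[volume.restrict (Ioo (0 : ℝ) ℓ)] u ∧
    u 0 = a ∧ u ℓ = b

theorem integrable_smul_intervalL2 {ℓ : ℝ} (f : IntervalL2 ℓ) {φ : ℝ → ℝ}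
    (hφ : Continuous φ) (hc : HasCompactSupport φ) :
    Integrable (fun x => φ x • f x) (volume.restrict (Ioo (0 : ℝ) ℓ)) := by
  obtain ⟨C, hC⟩ := hφ.bounded_above_of_compact_support hc
  exact ((Lp.memLp f).integrable one_le_two).bdd_smul C hφ.aestronglyMeasurable
    (Filter.Eventually.of_forall hC)

theorem integral_smul_add_intervalL2 {ℓ : ℝ} (f g : IntervalL2 ℓ) {φ : ℝ → ℝ}
    (hφ : Continuous φ) (hc : HasCompactSupport φ) :
    ∫ x in Ioo 0 ℓ, φ x • (f + g : IntervalL2 ℓ) x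
      = (∫ x in Ioo 0 ℓ, φ x • f x) + ∫ x in Ioo 0 ℓ, φ x • g x := by
  rw [← integral_add (integrable_smul_intervalL2 f hφ hc) (integrable_smul_intervalL2 g hφ hc)]
  refine integral_congr_ae ?_
  filter_upwards [Lp.coeFn_add f g] with x hx
  rw [hx, Pi.add_apply, smul_add]

theorem integral_smul_smul_intervalL2 {ℓ : ℝ} (c : ℂ) (f : IntervalL2 ℓ) (φ : ℝ → ℝ) :
    ∫ x in Ioo 0 ℓ, φ x • (c • f : IntervalL2 ℓ) x = c • ∫ x in Ioo 0 ℓ, φ x • f x := by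
  rw [← integral_smul]
  refine integral_congr_ae ?_
  filter_upwards [Lp.coeFn_smul c f] with x hx
  rw [hx, Pi.smul_apply, smul_comm]

theorem HasWeakDeriv.add {ℓ : ℝ} {f g f' g' : IntervalL2 ℓ} (h : HasWeakDeriv f g)
    (h' : HasWeakDeriv f' g') : HasWeakDeriv (f + f') (g + g') := by
  intro φ hφ hc hs
  rw [integral_smul_add_intervalL2 _ _ (hφ.continuous_deriv (by simp)) hc.deriv,
    integral_smul_add_intervalL2 _ _ hφ.continuous hc, h φ hφ hc hs, h' φ hφ hc hs, neg_add]

theorem HasWeakDeriv.smul {ℓ : ℝ} {f g : IntervalL2 ℓ} (c : ℂ) (h : HasWeakDeriv f g) :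
    HasWeakDeriv (c • f) (c • g) := by
  intro φ hφ hc hs
  rw [integral_smul_smul_intervalL2, integral_smul_smul_intervalL2, h φ hφ hc hs, smul_neg]

theorem hasWeakDeriv_zero {ℓ : ℝ} : HasWeakDeriv (0 : IntervalL2 ℓ) 0 := by
  intro φ hφ hc hs
  have h := integral_smul_smul_intervalL2 (ℓ := ℓ) 0 0
  simp only [zero_smul] at h
  rw [h, h, neg_zero]

/-- The weak derivative is unique. -/
theorem HasWeakDeriv.eq_zero {ℓ : ℝ} {g : IntervalL2 ℓ} (h : HasWeakDeriv 0 g) : g = 0 := by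
  have h0 := integral_smul_smul_intervalL2 (ℓ := ℓ) 0 0
  simp only [zero_smul] at h0
  have key := isOpen_Ioo.ae_eq_zero_of_integral_contDiff_smul_eq_zero (U := Ioo (0 : ℝ) ℓ)
    (μ := volume.restrict (Ioo (0 : ℝ) ℓ)) (f := (g : ℝ → ℂ))
    (((Lp.memLp g).integrable one_le_two).locallyIntegrable.locallyIntegrableOn _) ?_
  · rw [Lp.eq_zero_iff_ae_eq_zero]
    filter_upwards [key, ae_restrict_mem measurableSet_Ioo] with x hx hm using hx hm
  · intro φ hφ hc hs
    have := h φ hφ hc hs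
    rw [h0] at this
    exact neg_eq_zero.1 this.symm

theorem HasBoundaryValues.add {ℓ : ℝ} {f f' : IntervalL2 ℓ} {a b a' b' : ℂ}
    (h : HasBoundaryValues f a b) (h' : HasBoundaryValues f' a' b') :
    HasBoundaryValues (f + f') (a + a') (b + b') := by
  obtain ⟨u, hu, hf, rfl, rfl⟩ := h
  obtain ⟨u', hu', hf', rfl, rfl⟩ := h'
  exact ⟨u + u', hu.add hu', (Lp.coeFn_add f f').trans (hf.add hf'), rfl, rfl⟩

theorem HasBoundaryValues.smul {ℓ : ℝ} {f : IntervalL2 ℓ} {a b : ℂ} (c : ℂ)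
    (h : HasBoundaryValues f a b) : HasBoundaryValues (c • f) (c * a) (c * b) := by
  obtain ⟨u, hu, hf, rfl, rfl⟩ := h
  exact ⟨c • u, hu.const_smul c, (Lp.coeFn_smul c f).trans (hf.const_smul c), rfl, rfl⟩

theorem hasBoundaryValues_zero {ℓ : ℝ} : HasBoundaryValues (0 : IntervalL2 ℓ) 0 0 :=
  ⟨0, continuousOn_const, Lp.coeFn_zero ℂ 2 _, rfl, rfl⟩

/-! ### Metric graphs -/

/-- A metric graph without loops on the vertex set `V` with edge set `E` (parallel edges are
allowed). Each edge `e` is parametrized by the interval `[0, len e]`, running from the vertex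
`src e` at the parameter `0` to the vertex `tgt e` at the parameter `len e`. -/
structure MetricGraph (V E : Type*) where
  src : E → V
  tgt : E → V
  src_ne_tgt : ∀ e, src e ≠ tgt e
  len : E → ℝ
  len_pos : ∀ e, 0 < len e

namespace MetricGraph

section Combinatorics

variable {V E : Type*} (Γ : MetricGraph V E)

/-- The edge `e` is incident to the vertex `v`. -/
def Incident (e : E) (v : V) : Prop := Γ.src e = v ∨ Γ.tgt e = v

/-- The degree of a vertex: the number of edges incident to it. -/
def degree (v : V) : ℕ := {e | Γ.Incident e v}.ncard

/-- The simple graph in which two distinct vertices are adjacent if some edge joins them. -/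
def underlyingGraph : SimpleGraph V :=
  SimpleGraph.fromRel fun v w => ∃ e, Γ.src e = v ∧ Γ.tgt e = w

/-- The metric graph is connected. -/
def Connected : Prop := Γ.underlyingGraph.Connected

/-- `e₀` is a pendant edge, attached to the rest of the graph at `v₀`: its endpoints are `v₀`
and `v₁`, and `v₁` has degree one. -/
structure IsPendant (e₀ : E) (v₀ v₁ : V) : Prop where
  ends : (Γ.src e₀ = v₀ ∧ Γ.tgt e₀ = v₁) ∨ (Γ.src e₀ = v₁ ∧ Γ.tgt e₀ = v₀)
  degree_eq_one : Γ.degree v₁ = 1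

variable {Γ}

theorem IsPendant.incident {e₀ : E} {v₀ v₁ : V} (h : Γ.IsPendant e₀ v₀ v₁) :
    Γ.Incident e₀ v₁ :=
  h.ends.elim (fun h => Or.inr h.2) (fun h => Or.inl h.1)

theorem IsPendant.ne {e₀ : E} {v₀ v₁ : V} (h : Γ.IsPendant e₀ v₀ v₁) : v₀ ≠ v₁ := by
  rcases h.ends with ⟨rfl, rfl⟩ | ⟨rfl, rfl⟩
  · exact Γ.src_ne_tgt e₀
  · exact (Γ.src_ne_tgt e₀).symm

theorem IsPendant.not_incident {e₀ : E} {v₀ v₁ : V} (h : Γ.IsPendant e₀ v₀ v₁) {e : E}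
    (he : e ≠ e₀) : ¬ Γ.Incident e v₁ := by
  intro hi
  obtain ⟨e', he'⟩ := Set.ncard_eq_one.1 h.degree_eq_one
  have h1 : e ∈ {e | Γ.Incident e v₁} := hi
  have h2 : e₀ ∈ {e | Γ.Incident e v₁} := h.incident
  rw [he', Set.mem_singleton_iff] at h1 h2
  exact he (h1.trans h2.symm)

variable (Γ)

/-- The metric graph obtained by removing the pendant edge `e₀` together with its endpoint `v₁`
of degree one. -/
def removePendant {e₀ : E} {v₀ v₁ : V} (h : Γ.IsPendant e₀ v₀ v₁) :
    MetricGraph {v : V // v ≠ v₁} {e : E // e ≠ e₀} where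
  src e := ⟨Γ.src e, fun hv => h.not_incident e.2 (Or.inl hv)⟩
  tgt e := ⟨Γ.tgt e, fun hv => h.not_incident e.2 (Or.inr hv)⟩
  src_ne_tgt e := fun hv => Γ.src_ne_tgt e (congrArg Subtype.val hv)
  len e := Γ.len e
  len_pos e := Γ.len_pos e

end Combinatorics

/-! ### The standard Laplacian -/

section Laplacian

variable {V E : Type*} [Fintype E] (Γ : MetricGraph V E)

/-- The complex Hilbert space `L²(Γ)`, the orthogonal sum of the spaces `L²(0, len e)`. -/
abbrev L2 : Type _ := PiLp 2 fun e : E => IntervalL2 (Γ.len e)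

/-- `f` is continuous on `Γ` with the value `c v` at each vertex `v`, that is, for each edge the
boundary values of `f` at the two endpoints of the edge are the values of `c` there. -/
def HasVertexValues (f : Γ.L2) (c : V → ℂ) : Prop :=
  ∀ e, HasBoundaryValues (f e) (c (Γ.src e)) (c (Γ.tgt e))

open Classical in
/-- The Kirchhoff condition on the derivative `p` of a function: at each vertex `v`, the
derivatives at `v`, taken in the direction towards `v` along all edges incident to `v`, sum up
to zero. (The direction towards `v` is the positive one if `v = tgt e` and the negative one if
`v = src e`.) -/
def Kirchhoff (p : Γ.L2) : Prop :=
  ∃ a b : E → ℂ, (∀ e, HasBoundaryValues (p e) (a e) (b e)) ∧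
    ∀ v, ∑ e with Γ.tgt e = v, b e - ∑ e with Γ.src e = v, a e = 0

/-- The graph of the operator `-Δ`: the pairs `(f, g)` such that `f` is an edgewise `H²` function
which is continuous at each vertex and satisfies the Kirchhoff condition, and `g = -f''` on each
edge. -/
def laplacianGraph : Submodule ℂ (Γ.L2 × Γ.L2) where
  carrier := {q | ∃ p : Γ.L2, (∀ e, HasWeakDeriv (q.1 e) (p e)) ∧
    (∀ e, HasWeakDeriv (p e) (-(q.2 e))) ∧ (∃ c, Γ.HasVertexValues q.1 c) ∧ Γ.Kirchhoff p}
  zero_mem' := by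
    refine ⟨0, fun e => hasWeakDeriv_zero, fun e => ?_, ⟨0, fun e => hasBoundaryValues_zero⟩,
      ⟨0, 0, fun e => hasBoundaryValues_zero, fun v => by simp⟩⟩
    have h : -((0 : Γ.L2 × Γ.L2).2 e) = 0 := neg_zero
    rw [h]
    exact hasWeakDeriv_zero
  add_mem' := by
    rintro x y ⟨p, h1, h2, ⟨c, hc⟩, a, b, hab, hK⟩ ⟨p', h1', h2', ⟨c', hc'⟩, a', b', hab', hK'⟩
    refine ⟨p + p', fun e => (h1 e).add (h1' e), fun e => ?_,
      ⟨c + c', fun e => (hc e).add (hc' e)⟩,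
      ⟨a + a', b + b', fun e => (hab e).add (hab' e), fun v => ?_⟩⟩
    · have h : -((x + y).2 e) = -(x.2 e) + -(y.2 e) := neg_add _ _
      rw [h]
      exact (h2 e).add (h2' e)
    · simp only [Pi.add_apply, Finset.sum_add_distrib]
      linear_combination hK v + hK' v
  smul_mem' := by
    rintro z x ⟨p, h1, h2, ⟨c, hc⟩, a, b, hab, hK⟩
    refine ⟨z • p, fun e => (h1 e).smul z, fun e => ?_, ⟨z • c, fun e => (hc e).smul z⟩,
      ⟨z • a, z • b, fun e => (hab e).smul z, fun v => ?_⟩⟩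
    · have h : -((z • x).2 e) = z • -(x.2 e) := (smul_neg z (x.2 e)).symm
      rw [h]
      exact (h2 e).smul z
    · simp only [Pi.smul_apply, smul_eq_mul, ← Finset.mul_sum]
      linear_combination z * hK v

theorem laplacianGraph_single_valued (q : Γ.L2 × Γ.L2) (hq : q ∈ Γ.laplacianGraph)
    (h0 : q.1 = 0) : q.2 = 0 := by
  obtain ⟨p, h1, h2, -, -⟩ := hq
  ext1 e
  have hp : p e = 0 := by
    have h := h1 e
    rw [h0] at h
    exact HasWeakDeriv.eq_zero h
  have h := h2 e
  rw [hp] at h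
  exact neg_eq_zero.1 h.eq_zero

/-- The standard Laplacian `-Δ` on `Γ`, an unbounded operator in `L²(Γ)`. -/
def laplacian : Γ.L2 →ₗ.[ℂ] Γ.L2 := Γ.laplacianGraph.toLinearPMap

theorem laplacian_graph : Γ.laplacian.graph = Γ.laplacianGraph :=
  Γ.laplacianGraph.toLinearPMap_graph_eq Γ.laplacianGraph_single_valued

/-- The eigenspace `ker(-Δ - μ)`: all `f` in the domain of `-Δ` such that `-Δ f = μ f`. -/
def eigenspace (μ : ℝ) : Submodule ℂ Γ.L2 :=
  Γ.laplacian.graph.comap (LinearMap.prod LinearMap.id ((μ : ℂ) • LinearMap.id))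

/-- The real numbers `t` such that `-Δ` has at least `k` eigenvalues in `(-∞, t]`, counted with
multiplicities, i.e. such that there are `k` linearly independent eigenfunctions with
eigenvalues at most `t`. -/
def eigenvalueBounds (k : ℕ) : Set ℝ :=
  {t | ∃ f : Fin k → Γ.L2, LinearIndependent ℂ f ∧ ∀ i, ∃ μ ≤ t, f i ∈ Γ.eigenspace μ}

/-- The `k`-th eigenvalue `μ_k(Γ)` of `-Δ`, `k = 1, 2, …`, when the eigenvalues are ordered
non-decreasingly and counted with multiplicities: the least `t` such that `-Δ` has at least `k`
eigenvalues in `(-∞, t]`, counted with multiplicities. -/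
def eigenvalue (k : ℕ) : ℝ := sInf (Γ.eigenvalueBounds k)

end Laplacian

end MetricGraph

end

/-! The quadratic form of the Laplacian is `‖f'‖²` on `H¹(Γ)`. A function on `Γ'` extends to `Γ` by
its value at `v₀`, constantly along `e₀`; this leaves the form unchanged and adds `‖f‖²` on `e₀` to
the squared norm. Extending `k + 1` independent eigenfunctions of `Γ'` with eigenvalues at most `μ'
= μ_{k+1}(Γ')` gives a trial space of dimension `k + 1` on `Γ`. By min-max it contains some `f ≠ 0`
with `μ (‖f‖²_{Γ'} + ‖f‖²_{e₀}) ≤ ‖f'‖² ≤ μ' ‖f‖²_{Γ'}`, where `μ = μ_{k+1}(Γ)`. Connectedness and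
`k ≥ 1` give `μ > 0`, so `μ ≤ μ'`. If `μ = μ'`, then `f` vanishes on `e₀`, hence at `v₀`, and the
second estimate is an equality, which within the span holds only for eigenfunctions with eigenvalue
`μ'` (`norm_sq_le_of_mem_span`).

Min-max itself is derived from the operator definition. With `J : H¹(Γ) → L²(Γ)` the embedding, the
weak equation `⟪f', w'⟫ = μ ⟪f, w⟫` for all `w` says `u = (1 + μ) J†J u`, so the spectral theory of
the compact positive operator `J†J` yields `exists_minmax`. Compactness of `J` and the equivalence
of weak and genuine eigenfunctions both rest on the representation `f = a + V f'` on each edge, with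
`V` the Volterra operator (`hasWeakDeriv_iff`): `V` is compact, and `V + V†` has rank at most one,
which is Green's formula. -/

noncomputable section

/-! ### Weak eigenvectors of a compact embedding and the min-max principle -/

section WeakEigenvectors

open ContinuousLinearMap Module.End
open scoped InnerProductSpace

variable {K H : Type*} [NormedAddCommGroup K] [InnerProductSpace ℂ K]
  [NormedAddCommGroup H] [InnerProductSpace ℂ H]

/-- A weak eigenvector of the form `‖u‖² - ‖J u‖²` relative to the norm of `H`. -/
def IsWeakEigenvector (J : K →L[ℂ] H) (μ : ℝ) (u : K) : Prop :=
  ∀ w, ⟪u, w⟫_ℂ = (1 + μ : ℝ) * ⟪J u, J w⟫_ℂ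

variable {J : K →L[ℂ] H}

namespace IsWeakEigenvector

theorem norm_sq {μ : ℝ} {u : K} (h : IsWeakEigenvector J μ u) :
    ‖u‖ ^ 2 = (1 + μ) * ‖J u‖ ^ 2 := by
  have := h u
  rw [inner_self_eq_norm_sq_to_K, inner_self_eq_norm_sq_to_K] at this
  simp only [Complex.coe_algebraMap] at this
  exact_mod_cast this

theorem one_add_pos {μ : ℝ} {u : K} (h : IsWeakEigenvector J μ u) (hu : u ≠ 0) :
    0 < 1 + μ := by
  by_contra hc
  have h1 : 0 < ‖u‖ ^ 2 := by positivity
  have := h.norm_sq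
  nlinarith [sq_nonneg ‖J u‖]

end IsWeakEigenvector

variable [CompleteSpace K] [CompleteSpace H]

/-- The norm of a positive compact operator is an eigenvalue and bounds its quadratic form. -/
theorem exists_top_eigenvector [Nontrivial K] {T : K →L[ℂ] K} (hT : IsCompactOperator T)
    (hsymm : T.IsSymmetric) (hpos : ∀ u, u ≠ 0 → 0 < T.reApplyInnerSelf u) :
    ∃ s : ℝ, 0 < s ∧ (∃ u, u ≠ 0 ∧ T u = (s : ℂ) • u) ∧
      ∀ u, T.reApplyInnerSelf u ≤ s * ‖u‖ ^ 2 := by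
  have hs : 0 < ‖T‖ := by
    obtain ⟨u, hu⟩ := exists_ne (0 : K)
    rw [norm_pos_iff]
    rintro rfl
    simpa [reApplyInnerSelf_apply] using hpos u hu
  have hle : ∀ u, T.reApplyInnerSelf u ≤ ‖T‖ * ‖u‖ ^ 2 := by
    intro u
    have h := (le_abs_self _).trans (T.rayleighQuotient_le_norm u)
    rcases eq_or_ne u 0 with rfl | hu
    · simp [reApplyInnerSelf_apply]
    · rwa [rayleighQuotient, div_le_iff₀ (by positivity)] at h
  refine ⟨‖T‖, hs, ?_, hle⟩
  -- Were `‖T‖` in the resolvent set, the Rayleigh quotient would stay below `‖T‖ - ε`, although its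
  -- supremum is `‖T‖`. Compactness then turns this spectral value into an eigenvalue.
  have hmem : (‖T‖ : ℂ) ∈ spectrum ℂ T := by
    by_contra hcon
    obtain ⟨ε, hε, h⟩ := T.rayleighQuotient_le_of_norm_mem_resolventSet
      (by simpa [spectrum] using hcon)
    have hnn : ∀ u, 0 ≤ T.rayleighQuotient u := fun u => by
      rcases eq_or_ne u 0 with rfl | hu
      · simp
      · exact div_nonneg (hpos u hu).le (by positivity)
    have h1 : ‖T‖ ≤ ‖T‖ - ε := by
      conv_lhs => rw [T.norm_eq_iSup_rayleighQuotient hsymm]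
      exact ciSup_le fun u => by rw [abs_of_nonneg (hnn u)]; exact h u
    linarith
  have h := (hT.hasEigenvalue_iff_mem_spectrum (by exact_mod_cast hs.ne')).2 hmem
  obtain ⟨u, hu⟩ := h.exists_hasEigenvector
  exact ⟨u, hu.2, hu.apply_eq_smul⟩


theorem inner_adjoint_comp_self (u w : K) :
    ⟪(adjoint J ∘L J) u, w⟫_ℂ = ⟪J u, J w⟫_ℂ := by
  rw [comp_apply, adjoint_inner_left]

theorem isSymmetric_adjoint_comp_self (J : K →L[ℂ] H) : (adjoint J ∘L J).IsSymmetric := by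
  intro u w
  change ⟪(adjoint J ∘L J) u, w⟫_ℂ = ⟪u, (adjoint J ∘L J) w⟫_ℂ
  rw [inner_adjoint_comp_self, comp_apply, adjoint_inner_right]

theorem reApplyInnerSelf_adjoint_comp_self (u : K) :
    (adjoint J ∘L J).reApplyInnerSelf u = ‖J u‖ ^ 2 := by
  rw [reApplyInnerSelf_apply, inner_adjoint_comp_self, inner_self_eq_norm_sq]

/-- The Riesz form of the weak equation. Keeping `1 + μ` as a factor avoids a division, so `μ = -1`
needs no exclusion. -/
theorem isWeakEigenvector_iff {μ : ℝ} {u : K} :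
    IsWeakEigenvector J μ u ↔ u = ((1 + μ : ℝ) : ℂ) • (adjoint J ∘L J) u := by
  constructor
  · intro h
    refine ext_inner_right ℂ fun w => ?_
    rw [inner_smul_left, inner_adjoint_comp_self, Complex.conj_ofReal, h w]
  · intro h w
    conv_lhs => rw [h]
    rw [inner_smul_left, inner_adjoint_comp_self, Complex.conj_ofReal]

namespace IsWeakEigenvector

theorem apply_eq {μ : ℝ} {u : K} (h : IsWeakEigenvector J μ u) (hu : u ≠ 0) :
    (adjoint J ∘L J) u = (((1 + μ)⁻¹ : ℝ) : ℂ) • u := by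
  have h1 := (h.one_add_pos hu).ne'
  conv_rhs => rw [isWeakEigenvector_iff.1 h]
  rw [smul_smul, ← Complex.ofReal_mul, inv_mul_cancel₀ h1, Complex.ofReal_one, one_smul]

end IsWeakEigenvector

/-- On the orthogonal complement of an invariant subspace, the form is minimized by a weak
eigenvector. -/
theorem exists_minimizing_isWeakEigenvector (hJ : IsCompactOperator J)
    (hinj : Function.Injective J) (N : Submodule ℂ K)
    (hN : ∀ u ∈ N, (adjoint J ∘L J) u ∈ N) (hne : Nᗮ ≠ ⊥) :
    ∃ μ : ℝ, (∃ u ∈ Nᗮ, u ≠ 0 ∧ IsWeakEigenvector J μ u) ∧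
      ∀ u ∈ Nᗮ, (1 + μ) * ‖J u‖ ^ 2 ≤ ‖u‖ ^ 2 := by
  have hinv : ∀ u ∈ Nᗮ, (adjoint J ∘L J) u ∈ Nᗮ := by
    intro u hu
    rw [Submodule.mem_orthogonal]
    intro w hw
    have := isSymmetric_adjoint_comp_self J w u
    change ⟪(adjoint J ∘L J) w, u⟫_ℂ = ⟪w, (adjoint J ∘L J) u⟫_ℂ at this
    rw [← this]
    exact Submodule.inner_right_of_mem_orthogonal (hN w hw) hu
  have hTc : IsCompactOperator (adjoint J ∘L J) := hJ.clm_comp (adjoint J)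
  let S : Nᗮ →L[ℂ] Nᗮ := (adjoint J ∘L J).restrict hinv
  have hSval : ∀ u : Nᗮ, ((S u : Nᗮ) : K) = (adjoint J ∘L J) u := fun u => rfl
  have hSc : IsCompactOperator S := hTc.restrict' hinv
  have hSs : S.IsSymmetric := (isSymmetric_adjoint_comp_self J).restrict_invariant hinv
  have hSr : ∀ u : Nᗮ, S.reApplyInnerSelf u = ‖J u‖ ^ 2 := fun u => by
    rw [← reApplyInnerSelf_adjoint_comp_self]; rfl
  have : Nontrivial Nᗮ := Submodule.nontrivial_iff_ne_bot.2 hne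
  obtain ⟨s, hs, ⟨u, hu, hSu⟩, hle⟩ := exists_top_eigenvector hSc hSs (fun u hu => by
    rw [hSr]
    have : J u ≠ 0 := fun h => hu (Subtype.ext (hinj (h.trans (map_zero J).symm)))
    positivity)
  -- An eigenvalue `s` of `J†J` corresponds to `1 + μ = 1 / s`.
  refine ⟨s⁻¹ - 1, ⟨u, u.2, fun h => hu (Subtype.ext h), ?_⟩, fun w hw => ?_⟩
  · rw [isWeakEigenvector_iff, ← hSval, hSu, Submodule.coe_smul, smul_smul, ← Complex.ofReal_mul,
      add_sub_cancel, inv_mul_cancel₀ hs.ne', Complex.ofReal_one, one_smul]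
  · have := hle ⟨w, hw⟩
    rw [hSr] at this
    rw [add_sub_cancel, inv_mul_le_iff₀ hs]
    exact this

/-- Minimize the form on the orthogonal complement of the eigenvectors already found, which `J†J`
leaves invariant. The minimizer satisfies the earlier bound `hμ`, so `μ ≤ μ'` and the old
eigenvalues also lie below `μ'`. The new bound is stated on the complement of the old
`n`-dimensional span, since that is the codimension needed for min-max. -/
theorem exists_next_isWeakEigenvector (hJ : IsCompactOperator J) (hinj : Function.Injective J)
    (hinf : ¬ FiniteDimensional ℂ K) {n : ℕ} {v : Fin n → K} {μ : ℝ}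
    (hli : LinearIndependent ℂ v) (hv : ∀ i, ∃ ν ≤ μ, IsWeakEigenvector J ν (v i))
    (hμ : ∀ u ∈ (Submodule.span ℂ (range v))ᗮ, (1 + μ) * ‖J u‖ ^ 2 ≤ ‖u‖ ^ 2) :
    ∃ μ' : ℝ, (∃ w : Fin (n + 1) → K, LinearIndependent ℂ w ∧ range v ⊆ range w ∧
        ∀ i, ∃ ν ≤ μ', IsWeakEigenvector J ν (w i)) ∧
      ∀ u ∈ (Submodule.span ℂ (range v))ᗮ, (1 + μ') * ‖J u‖ ^ 2 ≤ ‖u‖ ^ 2 := by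
  have : FiniteDimensional ℂ (Submodule.span ℂ (range v)) :=
    FiniteDimensional.span_of_finite ℂ (finite_range v)
  have hinv : ∀ u ∈ Submodule.span ℂ (range v),
      (adjoint J ∘L J) u ∈ Submodule.span ℂ (range v) := by
    have : Submodule.span ℂ (range v) ≤ (Submodule.span ℂ (range v)).comap
        ((adjoint J ∘L J : K →L[ℂ] K) : K →ₗ[ℂ] K) := by
      rw [Submodule.span_le]
      rintro _ ⟨i, rfl⟩
      obtain ⟨ν, -, hν⟩ := hv i
      change (adjoint J ∘L J) (v i) ∈ Submodule.span ℂ (range v)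
      rw [hν.apply_eq (hli.ne_zero i)]
      exact Submodule.smul_mem _ _ (Submodule.subset_span ⟨i, rfl⟩)
    exact fun u hu => this hu
  have hne : (Submodule.span ℂ (range v))ᗮ ≠ ⊥ := by
    intro h
    rw [Submodule.orthogonal_eq_bot_iff] at h
    exact hinf (Module.finite_def.2 (h ▸ Submodule.fg_span (finite_range v)))
  obtain ⟨μ', ⟨u, huN, hu, hue⟩, hμ'⟩ :=
    exists_minimizing_isWeakEigenvector hJ hinj _ hinv hne
  have hJu : 0 < ‖J u‖ ^ 2 := by
    have : J u ≠ 0 := fun h => hu (hinj (h.trans (map_zero J).symm))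
    positivity
  have hμμ' : μ ≤ μ' := by
    have h1 := hμ u huN
    rw [hue.norm_sq] at h1
    linarith [le_of_mul_le_mul_right h1 hJu]
  refine ⟨μ', ⟨Fin.cons u v, ?_, ?_, ?_⟩, hμ'⟩
  · rw [linearIndependent_finCons]
    refine ⟨hli, fun h => hu ?_⟩
    exact (inner_self_eq_zero (𝕜 := ℂ)).1 (Submodule.inner_right_of_mem_orthogonal h huN)
  · rintro _ ⟨i, rfl⟩
    exact ⟨i.succ, by simp⟩
  · intro i
    refine Fin.cases ?_ (fun j => ?_) i
    · exact ⟨μ', le_rfl, by simpa using hue⟩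
    · obtain ⟨ν, h1, h2⟩ := hv j
      exact ⟨ν, h1.trans hμμ', by simpa using h2⟩

theorem exists_orthogonal_bound (hJ : IsCompactOperator J) (hinj : Function.Injective J)
    (hle : ∀ u, ‖J u‖ ≤ ‖u‖) (hinf : ¬ FiniteDimensional ℂ K) (n : ℕ) :
    ∃ v : Fin n → K, LinearIndependent ℂ v ∧ ∃ μ : ℝ,
      (∀ i, ∃ ν ≤ μ, IsWeakEigenvector J ν (v i)) ∧
      ∀ u ∈ (Submodule.span ℂ (range v))ᗮ, (1 + μ) * ‖J u‖ ^ 2 ≤ ‖u‖ ^ 2 := by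
  induction n with
  | zero =>
    -- With no eigenvectors the complement is all of `K`, and the bound for `μ = 0` is `hle`.
    refine ⟨Fin.elim0, linearIndependent_empty_type, 0, fun i => i.elim0, fun u _ => ?_⟩
    have := hle u
    rw [add_zero, one_mul]
    gcongr
  | succ n ih =>
    obtain ⟨v, hli, μ, hv, hμ⟩ := ih
    obtain ⟨μ', ⟨w, hw, hvw, hw'⟩, h⟩ := exists_next_isWeakEigenvector hJ hinj hinf hli hv hμ
    exact ⟨w, hw, μ', hw', fun u hu =>
      h u (Submodule.orthogonal_le (Submodule.span_mono hvw) hu)⟩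

/-- The min-max principle for the eigenvalues of the form. -/
theorem exists_minmax (hJ : IsCompactOperator J) (hinj : Function.Injective J)
    (hle : ∀ u, ‖J u‖ ≤ ‖u‖) (hinf : ¬ FiniteDimensional ℂ K) (n : ℕ) :
    ∃ μ : ℝ, (∃ w : Fin (n + 1) → K, LinearIndependent ℂ w ∧
        ∀ i, ∃ ν ≤ μ, IsWeakEigenvector J ν (w i)) ∧
      ∀ f : Fin (n + 1) → K, LinearIndependent ℂ f →
        ∃ u ∈ Submodule.span ℂ (range f), u ≠ 0 ∧ (1 + μ) * ‖J u‖ ^ 2 ≤ ‖u‖ ^ 2 := by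
  obtain ⟨v, hli, μ, hv, hμ⟩ := exists_orthogonal_bound hJ hinj hle hinf n
  obtain ⟨μ', ⟨w, hw, -, hw'⟩, h⟩ := exists_next_isWeakEigenvector hJ hinj hinf hli hv hμ
  refine ⟨μ', ⟨w, hw, hw'⟩, fun f hf => ?_⟩
  let N := Submodule.span ℂ (range v)
  let F := Submodule.span ℂ (range f)
  have : FiniteDimensional ℂ N := FiniteDimensional.span_of_finite ℂ (finite_range v)
  have : FiniteDimensional ℂ F := FiniteDimensional.span_of_finite ℂ (finite_range f)
  have hN : Module.finrank ℂ N = n := by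
    simpa using finrank_span_eq_card hli
  have hF : Module.finrank ℂ F = n + 1 := by
    simpa using finrank_span_eq_card hf
  -- Dimension count: the projection of an `(n + 1)`-dimensional space to an `n`-dimensional one
  -- kills some nonzero `u`.
  let P : F →ₗ[ℂ] N := N.orthogonalProjectionOnto.toLinearMap ∘ₗ F.subtype
  have hP : LinearMap.ker P ≠ ⊥ := P.ker_ne_bot_of_finrank_lt (by omega)
  obtain ⟨u, hu, hu0⟩ := (Submodule.ne_bot_iff _).1 hP
  refine ⟨u, u.2, fun h => hu0 (Subtype.ext h), h u ?_⟩
  exact (Submodule.orthogonalProjectionOnto_eq_zero_iff).1 hu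

/-- On the span of weak eigenvectors for eigenvalues at most `t`, the form is at most `t`, and
equality characterizes the weak eigenvectors for `t`. -/
theorem norm_sq_le_of_mem_span {ι : Type*} {v : ι → K} {t : ℝ}
    (hv : ∀ i, ∃ ν ≤ t, IsWeakEigenvector J ν (v i)) {u : K}
    (hu : u ∈ Submodule.span ℂ (range v)) :
    ‖u‖ ^ 2 ≤ (1 + t) * ‖J u‖ ^ 2 ∧
      (‖u‖ ^ 2 = (1 + t) * ‖J u‖ ^ 2 → IsWeakEigenvector J t u) := by
  set T := adjoint J ∘L J with hT
  -- The index condition is a division-free form of `s = 1 / (1 + ν)` with `ν ≤ t`. Splitting `u`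
  -- into its components `f s` in these orthogonal eigenspaces gives the deficit `∑ ((1 + t) s - 1)
  -- ‖f s‖²`, a sum of nonnegative terms; if it vanishes, only `s = 1 / (1 + t)` contributes.
  let G : {s : ℝ // 1 ≤ (1 + t) * s} → Submodule ℂ K :=
    fun s => eigenspace (T : Module.End ℂ K) ((s : ℝ) : ℂ)
  have hG : OrthogonalFamily ℂ (fun s => G s) fun s => (G s).subtypeₗᵢ :=
    (isSymmetric_adjoint_comp_self J).orthogonalFamily_eigenspaces.comp
      (f := fun s : {s : ℝ // 1 ≤ (1 + t) * s} => ((s : ℝ) : ℂ))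
      fun a b h => Subtype.ext (Complex.ofReal_injective h)
  have hspan : Submodule.span ℂ (range v) ≤ ⨆ s, G s := by
    rw [Submodule.span_le]
    rintro _ ⟨i, rfl⟩
    obtain ⟨ν, hν, he⟩ := hv i
    rcases eq_or_ne (v i) 0 with h0 | h0
    · rw [h0]; exact Submodule.zero_mem _
    have hpos := he.one_add_pos h0
    refine Submodule.mem_iSup_of_mem ⟨(1 + ν)⁻¹, ?_⟩ ?_
    · rw [← div_eq_mul_inv, one_le_div hpos]
      linarith
    · exact mem_eigenspace_iff.2 (he.apply_eq h0)
  obtain ⟨f, hf, hfu⟩ := (Submodule.mem_iSup_iff_exists_finsupp _ _).1 (hspan hu)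
  have hTf : ∀ s, T (f s) = ((s : ℝ) : ℂ) • f s := fun s => mem_eigenspace_iff.1 (hf s)
  let g : ∀ s, G s := fun s => ⟨f s, hf s⟩
  have hu_eq : u = ∑ s ∈ f.support, f s := hfu.symm
  have hn : ‖u‖ ^ 2 = ∑ s ∈ f.support, ‖f s‖ ^ 2 := by
    rw [hu_eq]
    exact hG.norm_sum g f.support
  have hTu : T u = ∑ s ∈ f.support, ((s : ℝ) : ℂ) • f s := by
    rw [hu_eq, map_sum]
    exact Finset.sum_congr rfl fun s _ => hTf s
  have hJn : ‖J u‖ ^ 2 = ∑ s ∈ f.support, (s : ℝ) * ‖f s‖ ^ 2 := by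
    rw [← reApplyInnerSelf_adjoint_comp_self, reApplyInnerSelf_apply, ← hT, hTu]
    conv_lhs => rw [hu_eq]
    have := hG.inner_sum (fun s => ((s : ℝ) : ℂ) • g s) g f.support
    simp only [Submodule.coe_subtypeₗᵢ, Submodule.coe_smul, Submodule.subtype_apply] at this
    rw [this, map_sum]
    refine Finset.sum_congr rfl fun s _ => ?_
    rw [inner_smul_left, Complex.conj_ofReal, inner_self_eq_norm_sq_to_K]
    simp only [Complex.coe_algebraMap]
    norm_cast
  have hdiff : (1 + t) * ‖J u‖ ^ 2 - ‖u‖ ^ 2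
      = ∑ s ∈ f.support, ((1 + t) * s - 1) * ‖f s‖ ^ 2 := by
    rw [hn, hJn, Finset.mul_sum, ← Finset.sum_sub_distrib]
    exact Finset.sum_congr rfl fun s _ => by ring
  have hnn : ∀ s ∈ f.support, 0 ≤ ((1 + t) * (s : ℝ) - 1) * ‖f s‖ ^ 2 := fun s _ =>
    mul_nonneg (by linarith [s.2]) (sq_nonneg _)
  refine ⟨by linarith [Finset.sum_nonneg hnn], fun heq => ?_⟩
  rw [isWeakEigenvector_iff, ← hT, hTu, Finset.smul_sum]
  conv_lhs => rw [hu_eq]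
  refine Finset.sum_congr rfl fun s hs => ?_
  have h0 := (Finset.sum_eq_zero_iff_of_nonneg hnn).1 (by linarith) s hs
  have hfs : f s ≠ 0 := Finsupp.mem_support_iff.1 hs
  have h1 : (1 + t) * (s : ℝ) = 1 := by
    rcases mul_eq_zero.1 h0 with h | h
    · linarith
    · exact absurd (norm_eq_zero.1 (pow_eq_zero_iff two_ne_zero |>.1 h)) hfs
  rw [smul_smul, ← Complex.ofReal_mul, h1, Complex.ofReal_one, one_smul]

end WeakEigenvectors

/-! ### Primitives of square-integrable functions and the Volterra operator -/

section Volterra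

open Filter Topology
open scoped InnerProductSpace

/-- Integration by parts for the primitives of two integrable functions. -/
theorem integral_mul_primitive_add {ν : Measure ℝ} [SFinite ν] [NullSingletonClass ν] {P Q : ℝ → ℂ}
    (hP : Integrable P ν) (hQ : Integrable Q ν) :
    (∫ x, P x * (∫ y in Iic x, Q y ∂ν) ∂ν) + ∫ x, (∫ y in Iic x, P y ∂ν) * Q x ∂ν
      = (∫ x, P x ∂ν) * ∫ x, Q x ∂ν := by
  have hF : Integrable (fun z : ℝ × ℝ => P z.1 * Q z.2) (ν.prod ν) := hP.mul_prod hQ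
  have hS : MeasurableSet {z : ℝ × ℝ | z.2 ≤ z.1} := measurableSet_le measurable_snd measurable_fst
  -- Fubini on the two sides of the diagonal. The complement is the strict region `x < y`; since
  -- points are null, `Iio` may replace `Iic` there.
  rw [← integral_prod_mul, ← integral_add_compl hS hF]
  congr 1
  · rw [← integral_indicator hS, integral_prod _ (hF.indicator hS)]
    refine integral_congr_ae (Eventually.of_forall fun x => ?_)
    dsimp only
    rw [← integral_const_mul, ← integral_indicator measurableSet_Iic]
    refine integral_congr_ae (Eventually.of_forall fun y => ?_)
    simp [indicator]
  · rw [← integral_indicator hS.compl, integral_prod_symm _ (hF.indicator hS.compl)]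
    refine integral_congr_ae (Eventually.of_forall fun y => ?_)
    dsimp only
    rw [integral_Iic_eq_integral_Iio, ← integral_mul_const, ← integral_indicator measurableSet_Iio]
    refine integral_congr_ae (Eventually.of_forall fun x => ?_)
    simp [indicator]

variable {ℓ : ℝ}

/-- The constant function `1` in `L²(0, ℓ)`. -/
def oneL2 (ℓ : ℝ) : IntervalL2 ℓ :=
  indicatorConstLp 2 MeasurableSet.univ (measure_ne_top _ _) 1

/-- The primitive of `p` vanishing at `0`. -/
def primitive (p : IntervalL2 ℓ) (x : ℝ) : ℂ :=
  ∫ y in Iic x, p y ∂(volume.restrict (Ioo 0 ℓ))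

theorem integrable_intervalL2 (p : IntervalL2 ℓ) : Integrable p (volume.restrict (Ioo 0 ℓ)) :=
  (Lp.memLp p).integrable one_le_two

theorem coeFn_oneL2 : oneL2 ℓ =ᵐ[volume.restrict (Ioo 0 ℓ)] fun _ => 1 := by
  filter_upwards [indicatorConstLp_coeFn (p := 2) (hs := MeasurableSet.univ)
    (hμs := measure_ne_top (volume.restrict (Ioo 0 ℓ)) univ) (c := (1 : ℂ))] with x hx
  exact hx.trans (by simp)

theorem inner_oneL2_left (p : IntervalL2 ℓ) : ⟪oneL2 ℓ, p⟫_ℂ = ∫ x in Ioo 0 ℓ, p x := by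
  rw [oneL2, L2.inner_indicatorConstLp_one, Measure.restrict_univ]

theorem primitive_add (p q : IntervalL2 ℓ) (x : ℝ) :
    primitive (p + q) x = primitive p x + primitive q x := by
  rw [primitive, primitive, primitive, ← integral_add (integrable_intervalL2 p).restrict
    (integrable_intervalL2 q).restrict]
  exact integral_congr_ae (ae_restrict_of_ae (Lp.coeFn_add p q))

theorem primitive_smul (c : ℂ) (p : IntervalL2 ℓ) (x : ℝ) :
    primitive (c • p) x = c * primitive p x := by
  rw [primitive, primitive, ← integral_const_mul]
  exact integral_congr_ae (ae_restrict_of_ae (Lp.coeFn_smul c p))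

theorem primitive_of_nonpos (p : IntervalL2 ℓ) {x : ℝ} (hx : x ≤ 0) : primitive p x = 0 := by
  rw [primitive, Measure.restrict_restrict measurableSet_Iic]
  have : Iic x ∩ Ioo 0 ℓ = ∅ := by
    ext y
    simp only [mem_inter_iff, mem_Iic, mem_Ioo, mem_empty_iff_false, iff_false]
    intro h
    linarith [h.1, h.2.1]
  rw [this]
  simp

theorem primitive_of_le (p : IntervalL2 ℓ) {x : ℝ} (hx : ℓ ≤ x) :
    primitive p x = ⟪oneL2 ℓ, p⟫_ℂ := by
  rw [primitive, Measure.restrict_restrict measurableSet_Iic, inner_oneL2_left]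
  congr 2
  exact inter_eq_right.2 fun y hy => hy.2.le.trans hx

/-- Cauchy–Schwarz against the indicator of `(x, y]`. The bound is uniform over the unit ball, so it
yields operator norm estimates as well as continuity. -/
theorem norm_primitive_sub_le (p : IntervalL2 ℓ) {x y : ℝ} (hxy : x ≤ y) :
    ‖primitive p y - primitive p x‖ ≤ √(y - x) * ‖p‖ := by
  have hfin : (volume.restrict (Ioo 0 ℓ)) (Ioc x y) ≠ ⊤ := measure_ne_top _ _
  have h : primitive p y - primitive p x
      = ⟪indicatorConstLp 2 measurableSet_Ioc hfin (1 : ℂ), p⟫_ℂ := by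
    rw [L2.inner_indicatorConstLp_one, primitive, primitive,
      intervalIntegral.integral_Iic_sub_Iic (integrable_intervalL2 p).integrableOn
        (integrable_intervalL2 p).integrableOn, intervalIntegral.integral_of_le hxy]
  rw [h]
  refine (norm_inner_le_norm _ _).trans ?_
  gcongr
  rw [norm_indicatorConstLp two_ne_zero ENNReal.ofNat_ne_top, norm_one, one_mul,
    ENNReal.toReal_ofNat, ← Real.sqrt_eq_rpow]
  apply Real.sqrt_le_sqrt
  rw [measureReal_restrict_apply measurableSet_Ioc]
  refine (measureReal_mono inter_subset_left (by simp)).trans ?_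
  rw [Real.volume_real_Ioc_of_le hxy]

theorem continuous_primitive (p : IntervalL2 ℓ) : Continuous (primitive p) := by
  have h : ∀ x y, dist (primitive p y) (primitive p x) ≤ √|y - x| * ‖p‖ := by
    intro x y
    rw [dist_eq_norm]
    rcases le_total x y with hxy | hxy
    · rw [abs_of_nonneg (sub_nonneg.2 hxy)]
      exact norm_primitive_sub_le p hxy
    · rw [abs_sub_comm, abs_of_nonneg (sub_nonneg.2 hxy), norm_sub_rev]
      exact norm_primitive_sub_le p hxy
  rw [continuous_iff_continuousAt]
  intro x
  rw [ContinuousAt, tendsto_iff_dist_tendsto_zero]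
  refine squeeze_zero (fun _ => dist_nonneg) (h x) ?_
  have : Continuous fun y => √|y - x| * ‖p‖ := by fun_prop
  simpa using this.tendsto x

theorem norm_primitive_le (p : IntervalL2 ℓ) {x : ℝ} (hx : x ≤ ℓ) :
    ‖primitive p x‖ ≤ √ℓ * ‖p‖ := by
  rcases le_total x 0 with h0 | h0
  · rw [primitive_of_nonpos p h0, norm_zero]
    positivity
  · have := norm_primitive_sub_le p h0
    rw [primitive_of_nonpos p le_rfl, sub_zero, sub_zero] at this
    exact this.trans (by gcongr)

theorem norm_intervalL2_le {f : IntervalL2 ℓ} {u : ℝ → ℂ} {C : ℝ} (hC : 0 ≤ C)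
    (hf : f =ᵐ[volume.restrict (Ioo 0 ℓ)] u) (hu : ∀ x ∈ Ioo 0 ℓ, ‖u x‖ ≤ C) :
    ‖f‖ ≤ √ℓ * C := by
  have h : ∀ᵐ x ∂(volume.restrict (Ioo 0 ℓ)), ‖f x‖ ≤ C := by
    filter_upwards [hf, ae_restrict_mem measurableSet_Ioo] with x hx hm
    rw [hx]
    exact hu x hm
  refine (Lp.norm_le_of_ae_bound hC h).trans ?_
  gcongr
  have hm : (measureUnivNNReal (volume.restrict (Ioo (0 : ℝ) ℓ)) : ℝ) = max ℓ 0 := by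
    rw [measureUnivNNReal, ENNReal.coe_toNNReal_eq_toReal]
    simp [ENNReal.toReal_ofReal']
  rw [ENNReal.toReal_ofNat, hm, ← one_div, ← Real.sqrt_eq_rpow]
  rcases le_total 0 ℓ with h0 | h0
  · rw [max_eq_left h0]
  · rw [max_eq_right h0, Real.sqrt_zero]
    positivity

theorem memLp_of_bound {u : ℝ → ℂ} {C : ℝ} (hm : Measurable u) (hu : ∀ x ∈ Ioo 0 ℓ, ‖u x‖ ≤ C) :
    MemLp u 2 (volume.restrict (Ioo 0 ℓ)) :=
  MemLp.of_bound hm.aestronglyMeasurable C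
    ((ae_restrict_iff' measurableSet_Ioo).2 (Eventually.of_forall hu))

theorem memLp_primitive (p : IntervalL2 ℓ) : MemLp (primitive p) 2 (volume.restrict (Ioo 0 ℓ)) :=
  memLp_of_bound (continuous_primitive p).measurable fun _ hx => norm_primitive_le p hx.2.le

/-- The Volterra operator, which maps a function to its primitive vanishing at `0`. -/
def volterra (ℓ : ℝ) : IntervalL2 ℓ →L[ℂ] IntervalL2 ℓ :=
  LinearMap.mkContinuous
    { toFun := fun p => (memLp_primitive p).toLp
      map_add' := fun p q => by
        rw [← MemLp.toLp_add]
        congr 1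
        ext x
        exact primitive_add p q x
      map_smul' := fun c p => by
        rw [RingHom.id_apply, ← MemLp.toLp_const_smul]
        congr 1
        ext x
        exact primitive_smul c p x }
    (√ℓ * √ℓ) fun p => by
      rw [mul_assoc]
      exact norm_intervalL2_le (by positivity) (MemLp.coeFn_toLp (memLp_primitive p))
        fun x hx => norm_primitive_le p hx.2.le

theorem coeFn_volterra (p : IntervalL2 ℓ) :
    volterra ℓ p =ᵐ[volume.restrict (Ioo 0 ℓ)] primitive p :=
  MemLp.coeFn_toLp (memLp_primitive p)

/-- The Volterra operator and its adjoint sum up to the projection onto the constants (up to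
normalization). -/
theorem inner_volterra_add (p q : IntervalL2 ℓ) :
    ⟪p, volterra ℓ q⟫_ℂ + ⟪volterra ℓ p, q⟫_ℂ = ⟪p, oneL2 ℓ⟫_ℂ * ⟪oneL2 ℓ, q⟫_ℂ := by
  have hconj : Integrable (fun x => (starRingEnd ℂ) (p x)) (volume.restrict (Ioo 0 ℓ)) :=
    Complex.conjCLE.toContinuousLinearMap.integrable_comp (integrable_intervalL2 p)
  have key := integral_mul_primitive_add hconj (integrable_intervalL2 q)
  rw [← inner_conj_symm p (oneL2 ℓ), inner_oneL2_left, inner_oneL2_left, ← integral_conj, ← key,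
    L2.inner_def, L2.inner_def]
  congr 1
  · refine integral_congr_ae ?_
    filter_upwards [coeFn_volterra q] with x hx
    rw [hx, RCLike.inner_apply, mul_comm]
    rfl
  · refine integral_congr_ae ?_
    filter_upwards [coeFn_volterra p] with x hx
    rw [hx, RCLike.inner_apply, mul_comm, primitive, integral_conj]

end Volterra

/-! ### Compactness of the Volterra operator -/

section Volterra

open Filter Topology
open scoped InnerProductSpace

variable {ℓ : ℝ}

theorem memLp_step (m N : ℕ) (c : Fin (N + 1) → ℂ) :
    MemLp (fun x : ℝ => c (Fin.ofNat (N + 1) ⌊m * x⌋₊)) 2 (volume.restrict (Ioo 0 ℓ)) :=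
  memLp_of_bound (C := ‖c‖)
    ((measurable_from_top (f := fun i : ℕ => c (Fin.ofNat (N + 1) i))).comp
      (Nat.measurable_floor.comp (measurable_const.mul measurable_id)))
    fun _ _ => norm_le_pi_norm c _

/-- The step function on `(0, ℓ)` with the values `c i` on the intervals `[i / m, (i + 1) / m)`. -/
def stepFunction (ℓ : ℝ) (m N : ℕ) : (Fin (N + 1) → ℂ) →ₗ[ℂ] IntervalL2 ℓ where
  toFun c := (memLp_step m N c).toLp
  map_add' c d := MemLp.toLp_add (memLp_step m N c) (memLp_step m N d)
  map_smul' a c := MemLp.toLp_const_smul a (memLp_step m N c)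

theorem coeFn_stepFunction (m N : ℕ) (c : Fin (N + 1) → ℂ) :
    stepFunction ℓ m N c =ᵐ[volume.restrict (Ioo 0 ℓ)]
      fun x => c (Fin.ofNat (N + 1) ⌊m * x⌋₊) :=
  MemLp.coeFn_toLp (memLp_step m N c)

/-- Evaluation of the primitive at a point. -/
def primitiveAt (ℓ x : ℝ) : IntervalL2 ℓ →L[ℂ] ℂ :=
  innerSL ℂ (indicatorConstLp 2 (measurableSet_Iic (a := x))
    (measure_ne_top (volume.restrict (Ioo 0 ℓ)) _) (1 : ℂ))

theorem primitiveAt_apply (x : ℝ) (p : IntervalL2 ℓ) : primitiveAt ℓ x p = primitive p x := by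
  rw [primitiveAt, innerSL_apply_apply, L2.inner_indicatorConstLp_one, primitive]

/-- A finite rank approximation of the Volterra operator. -/
def volterraStep (ℓ : ℝ) (m : ℕ) : IntervalL2 ℓ →L[ℂ] IntervalL2 ℓ :=
  (stepFunction ℓ m ⌊m * ℓ⌋₊).toContinuousLinearMap ∘L
    ContinuousLinearMap.pi fun i : Fin (⌊m * ℓ⌋₊ + 1) => primitiveAt ℓ ((i : ℕ) / m)

theorem isCompactOperator_volterraStep (m : ℕ) : IsCompactOperator (volterraStep ℓ m) :=
  (isCompactOperator_of_locallyCompactSpace_rng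
    (stepFunction ℓ m ⌊m * ℓ⌋₊).toContinuousLinearMap).comp_clm _

theorem norm_volterra_sub_volterraStep_le (m : ℕ) (hm : 0 < m) :
    ‖volterra ℓ - volterraStep ℓ m‖ ≤ √ℓ * √(1 / m) := by
  refine ContinuousLinearMap.opNorm_le_bound _ (by positivity) fun p => ?_
  rw [mul_assoc]
  have hae : (volterra ℓ - volterraStep ℓ m) p =ᵐ[volume.restrict (Ioo 0 ℓ)]
      fun x => primitive p x
        - primitive p (((Fin.ofNat (⌊m * ℓ⌋₊ + 1) ⌊m * x⌋₊ : Fin _) : ℕ) / m) := by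
    rw [sub_apply]
    filter_upwards [Lp.coeFn_sub (volterra ℓ p) (volterraStep ℓ m p), coeFn_volterra p,
      coeFn_stepFunction m ⌊m * ℓ⌋₊ fun i => primitiveAt ℓ ((i : ℕ) / m) p] with x h1 h2 h3
    rw [h1, Pi.sub_apply, h2, ← primitiveAt_apply, ← primitiveAt_apply]
    congr 1
  refine norm_intervalL2_le (by positivity) hae fun x hx => ?_
  have hm' : (0 : ℝ) < m := by exact_mod_cast hm
  -- For `x` in `(0, ℓ)` the index is in range, so the reduction modulo `N + 1` in `Fin.ofNat` has
  -- no effect.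
  have hlt : ⌊m * x⌋₊ < ⌊m * ℓ⌋₊ + 1 :=
    Nat.lt_succ_of_le (Nat.floor_le_floor (by nlinarith [hx.2]))
  rw [Fin.val_ofNat, Nat.mod_eq_of_lt hlt]
  have h1 : (⌊m * x⌋₊ : ℝ) / m ≤ x := by
    rw [div_le_iff₀ hm', mul_comm]
    exact Nat.floor_le (by nlinarith [hx.1])
  have h2 : x - (⌊m * x⌋₊ : ℝ) / m ≤ 1 / m := by
    rw [sub_le_iff_le_add, ← add_div, le_div_iff₀ hm']
    linarith [Nat.lt_floor_add_one (m * x)]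
  exact (norm_primitive_sub_le p h1).trans (by gcongr)

/-- Sampling the primitive at multiples of `1 / m` has finite rank and an error of order `m ^
(-1/2)` in operator norm. -/
theorem isCompactOperator_volterra : IsCompactOperator (volterra ℓ) := by
  have h : Tendsto (fun m : ℕ => volterraStep ℓ (m + 1)) atTop (𝓝 (volterra ℓ)) := by
    rw [tendsto_iff_norm_sub_tendsto_zero]
    refine squeeze_zero (g := fun m : ℕ => √ℓ * √(1 / ((m : ℝ) + 1))) (fun _ => norm_nonneg _)
      (fun m => ?_) ?_
    · rw [norm_sub_rev]
      have := norm_volterra_sub_volterraStep_le (ℓ := ℓ) (m + 1) m.succ_pos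
      rwa [Nat.cast_add_one] at this
    · have := (tendsto_one_div_add_atTop_nhds_zero_nat (𝕜 := ℝ)).sqrt.const_mul √ℓ
      simpa using this
  exact isCompactOperator_of_tendsto h
    (Eventually.of_forall fun m => isCompactOperator_volterraStep (m + 1))

end Volterra

/-! ### Weak derivatives and boundary values in terms of primitives -/

section WeakDerivative

open Filter Topology
open scoped InnerProductSpace

variable {ℓ : ℝ}

theorem HasWeakDeriv.neg {f g : IntervalL2 ℓ} (h : HasWeakDeriv f g) :
    HasWeakDeriv (-f) (-g) := by
  simpa using h.smul (-1)

theorem HasWeakDeriv.sub {f g f' g' : IntervalL2 ℓ} (h : HasWeakDeriv f g)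
    (h' : HasWeakDeriv f' g') : HasWeakDeriv (f - f') (g - g') := by
  simpa [sub_eq_add_neg] using h.add h'.neg

theorem eq_zero_of_tsupport_subset {φ : ℝ → ℝ} (hs : tsupport φ ⊆ Ioo 0 ℓ) {x : ℝ}
    (hx : x ∉ Ioo 0 ℓ) : φ x = 0 :=
  image_eq_zero_of_notMem_tsupport fun h => hx (hs h)

theorem setIntegral_Ioo_deriv {φ : ℝ → ℝ} (hφ : ContDiff ℝ ∞ φ) {x : ℝ} (hx : 0 ≤ x) :
    ∫ y in Ioo 0 x, ((deriv φ y : ℝ) : ℂ) = φ x - φ 0 := by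
  rw [integral_complex_ofReal, ← integral_Ioc_eq_integral_Ioo, ← intervalIntegral.integral_of_le hx,
    intervalIntegral.integral_deriv_eq_sub
      (fun y _ => (hφ.differentiable (by simp)).differentiableAt)
      ((hφ.continuous_deriv (by simp)).intervalIntegrable _ _)]
  push_cast
  rfl

theorem hasWeakDeriv_oneL2 (hℓ : 0 ≤ ℓ) : HasWeakDeriv (oneL2 ℓ) 0 := by
  intro φ hφ hc hs
  have h1 : ∫ x in Ioo 0 ℓ, deriv φ x • oneL2 ℓ x = ∫ x in Ioo 0 ℓ, ((deriv φ x : ℝ) : ℂ) := by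
    refine integral_congr_ae ?_
    filter_upwards [coeFn_oneL2] with x hx
    rw [hx, Complex.real_smul, mul_one]
  have h2 : ∫ x in Ioo 0 ℓ, φ x • (0 : IntervalL2 ℓ) x = 0 := by
    rw [← integral_zero ℝ ℂ (μ := volume.restrict (Ioo 0 ℓ))]
    refine integral_congr_ae ?_
    filter_upwards [Lp.coeFn_zero ℂ 2 (volume.restrict (Ioo 0 ℓ))] with x hx
    rw [hx, Pi.zero_apply, smul_zero]
  rw [h1, h2, setIntegral_Ioo_deriv hφ hℓ, eq_zero_of_tsupport_subset hs (by simp),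
    eq_zero_of_tsupport_subset hs (by simp)]
  simp

/-- Integration by parts for `φ'` and `p`: the primitive of `φ'` is `φ`, and the boundary product
vanishes because `∫ φ' = 0`. -/
theorem hasWeakDeriv_volterra (hℓ : 0 ≤ ℓ) (p : IntervalL2 ℓ) :
    HasWeakDeriv (volterra ℓ p) p := by
  intro φ hφ hc hs
  have hd : Integrable (fun x => ((deriv φ x : ℝ) : ℂ)) (volume.restrict (Ioo 0 ℓ)) :=
    ((hφ.continuous_deriv (by simp)).integrable_of_hasCompactSupport hc.deriv).ofReal.restrict
  have key := integral_mul_primitive_add hd (integrable_intervalL2 p)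
  have h0 : φ 0 = 0 := eq_zero_of_tsupport_subset hs (by simp)
  have hl : φ ℓ = 0 := eq_zero_of_tsupport_subset hs (by simp)
  rw [setIntegral_Ioo_deriv hφ hℓ, h0, hl, sub_self, zero_mul] at key
  rw [eq_neg_iff_add_eq_zero, ← key]
  congr 1
  · refine integral_congr_ae ?_
    filter_upwards [coeFn_volterra p] with x hx
    rw [hx, Complex.real_smul]
    rfl
  · refine integral_congr_ae ?_
    filter_upwards [ae_restrict_mem measurableSet_Ioo] with x hx
    have : Iic x ∩ Ioo 0 ℓ = Ioc 0 x := by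
      ext y
      simp only [mem_inter_iff, mem_Iic, mem_Ioo, mem_Ioc]
      constructor
      · intro h; exact ⟨h.2.1, h.1⟩
      · intro h; exact ⟨h.2, h.1, h.2.trans_lt hx.2⟩
    rw [Measure.restrict_restrict measurableSet_Iic, this, integral_Ioc_eq_integral_Ioo,
      setIntegral_Ioo_deriv hφ hx.1.le, h0, Complex.ofReal_zero, sub_zero, Complex.real_smul]

/-- A test function with vanishing integral is the derivative of a test function. -/
theorem exists_deriv_eq_of_integral_eq_zero (hℓ : 0 < ℓ) {ψ : ℝ → ℝ} (hψ : ContDiff ℝ ∞ ψ)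
    (hc : HasCompactSupport ψ) (hs : tsupport ψ ⊆ Ioo 0 ℓ) (h0 : ∫ x, ψ x = 0) :
    ∃ φ : ℝ → ℝ, ContDiff ℝ ∞ φ ∧ HasCompactSupport φ ∧ tsupport φ ⊆ Ioo 0 ℓ ∧ deriv φ = ψ := by
  -- The extra point keeps the set nonempty when `ψ = 0`.
  have hK : IsCompact (insert (ℓ / 2) (tsupport ψ)) := IsCompact.insert hc _
  have hKs : insert (ℓ / 2) (tsupport ψ) ⊆ Ioo 0 ℓ :=
    insert_subset ⟨by linarith, by linarith⟩ hs
  obtain ⟨α, hαm, hα⟩ := hK.exists_isLeast (insert_nonempty _ _)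
  obtain ⟨β, hβm, hβ⟩ := hK.exists_isGreatest (insert_nonempty _ _)
  have hα0 := (hKs hαm).1
  have hβl := (hKs hβm).2
  have hzα : ∀ x < α, ψ x = 0 := fun x hx => image_eq_zero_of_notMem_tsupport fun h =>
    hx.not_ge (hα (mem_insert_of_mem _ h))
  have hzβ : ∀ x, β < x → ψ x = 0 := fun x hx => image_eq_zero_of_notMem_tsupport fun h =>
    hx.not_ge (hβ (mem_insert_of_mem _ h))
  have hd : ∀ x, HasDerivAt (fun x => ∫ t in (0 : ℝ)..x, ψ t) (ψ x) x := fun x =>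
    intervalIntegral.integral_hasDerivAt_right (hψ.continuous.intervalIntegrable _ _)
      (hψ.continuous.stronglyMeasurableAtFilter _ _) hψ.continuous.continuousAt
  have hderiv : deriv (fun x => ∫ t in (0 : ℝ)..x, ψ t) = ψ := funext fun x => (hd x).deriv
  -- Left of `α` the integrand vanishes; right of `β` the integral is the full one, which is zero by
  -- `h0`.
  have hsupp : tsupport (fun x => ∫ t in (0 : ℝ)..x, ψ t) ⊆ Icc α β := by
    refine closure_minimal (fun x hx => ?_) isClosed_Icc
    by_contra hcon
    refine hx ?_
    rw [mem_Icc, not_and_or, not_le, not_le] at hcon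
    dsimp only
    rcases hcon with h | h
    · rw [intervalIntegral.integral_congr (g := fun _ => (0 : ℝ)) fun t ht =>
        hzα t (ht.2.trans_lt (max_lt hα0 h)), intervalIntegral.integral_zero]
    · rw [intervalIntegral.integral_eq_integral_of_support_subset, h0]
      intro t ht
      have h1 := hs (subset_tsupport _ ht)
      refine ⟨h1.1, le_of_not_gt fun h2 => ht (hzβ t (h.trans h2))⟩
  refine ⟨_, contDiff_infty_iff_deriv.2 ⟨fun x => (hd x).differentiableAt, ?_⟩,
    isCompact_Icc.of_isClosed_subset (isClosed_tsupport _) hsupp,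
    hsupp.trans (Icc_subset_Ioo hα0 hβl), hderiv⟩
  rw [hderiv]
  exact hψ

theorem exists_testFunction_integral_eq_one (hℓ : 0 < ℓ) :
    ∃ η : ℝ → ℝ, ContDiff ℝ ∞ η ∧ HasCompactSupport η ∧ tsupport η ⊆ Ioo 0 ℓ ∧
      ∫ x, η x = 1 := by
  let b : ContDiffBump (ℓ / 2) := ⟨ℓ / 8, ℓ / 4, by linarith, by linarith⟩
  refine ⟨b.normed volume, b.contDiff_normed, b.hasCompactSupport_normed, ?_, b.integral_normed⟩
  rw [b.tsupport_normed_eq, Real.closedBall_eq_Icc]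
  refine Icc_subset_Ioo ?_ ?_
  · change 0 < ℓ / 2 - ℓ / 4
    linarith
  · change ℓ / 2 + ℓ / 4 < ℓ
    linarith

/-- A function with vanishing weak derivative is constant. -/
theorem HasWeakDeriv.exists_eq_smul_oneL2 (hℓ : 0 < ℓ) {f : IntervalL2 ℓ}
    (h : HasWeakDeriv f 0) : ∃ a : ℂ, f = a • oneL2 ℓ := by
  obtain ⟨η, hη, hηc, hηs, hη1⟩ := exists_testFunction_integral_eq_one hℓ
  have hint : ∀ φ : ℝ → ℝ, ContDiff ℝ ∞ φ → HasCompactSupport φ → tsupport φ ⊆ Ioo 0 ℓ →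
      ∫ x in Ioo 0 ℓ, deriv φ x • f x = 0 := by
    intro φ hφ hc hs
    rw [h φ hφ hc hs, neg_eq_zero, ← integral_zero ℝ ℂ (μ := volume.restrict (Ioo 0 ℓ))]
    refine integral_congr_ae ?_
    filter_upwards [Lp.coeFn_zero ℂ 2 (volume.restrict (Ioo 0 ℓ))] with x hx
    rw [hx, Pi.zero_apply, smul_zero]
  set a := ∫ x in Ioo 0 ℓ, η x • f x with ha
  refine ⟨a, ?_⟩
  have hfin : ∀ g : ℝ → ℝ, ContDiff ℝ ∞ g → HasCompactSupport g → tsupport g ⊆ Ioo 0 ℓ →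
      ∫ x in Ioo 0 ℓ, g x • (f - a • oneL2 ℓ : IntervalL2 ℓ) x = 0 := by
    intro g hg hgc hgs
    set c := ∫ x, g x with hcdef
    have hgI : Integrable g := hg.continuous.integrable_of_hasCompactSupport hgc
    have hηI : Integrable η := hη.continuous.integrable_of_hasCompactSupport hηc
    -- The du Bois-Reymond argument: `g - (∫ g) η` has mean zero, so it is the derivative of a test
    -- function and `f` annihilates it.
    obtain ⟨φ, hφ, hφc, hφs, hφd⟩ := exists_deriv_eq_of_integral_eq_zero (ψ := fun x => g x - c * η x)
      hℓ (hg.sub (contDiff_const.mul hη)) (hgc.sub (hηc.mul_left (f := fun _ => c)))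
      ((tsupport_sub _ _).trans (union_subset hgs
        ((tsupport_mul_subset_right (f := fun _ => c)).trans hηs)))
      (by rw [integral_sub hgI (hηI.const_mul c), integral_const_mul, hη1, mul_one, sub_self])
    have h1 := hint φ hφ hφc hφs
    rw [hφd] at h1
    have h2 : ∫ x in Ioo 0 ℓ, g x • (f - a • oneL2 ℓ : IntervalL2 ℓ) x
        = (∫ x in Ioo 0 ℓ, g x • f x) - ∫ x in Ioo 0 ℓ, ((g x : ℝ) : ℂ) * a := by
      have hI : Integrable (fun x => ((g x : ℝ) : ℂ) * a) (volume.restrict (Ioo 0 ℓ)) :=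
        hgI.ofReal.restrict.mul_const a
      rw [← integral_sub (integrable_smul_intervalL2 f hg.continuous hgc) hI]
      refine integral_congr_ae ?_
      filter_upwards [Lp.coeFn_sub f (a • oneL2 ℓ), Lp.coeFn_smul a (oneL2 ℓ), coeFn_oneL2]
        with x h1 h2 h3
      rw [h1, Pi.sub_apply, h2, Pi.smul_apply, h3, smul_sub, smul_eq_mul, mul_one,
        Complex.real_smul, Complex.real_smul]
    have h3 : ∫ x in Ioo 0 ℓ, ((g x : ℝ) : ℂ) * a = c * a := by
      rw [integral_mul_const, integral_complex_ofReal, hcdef,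
        setIntegral_eq_integral_of_forall_compl_eq_zero
          (fun x hx => eq_zero_of_tsupport_subset hgs hx)]
    have h4 : ∫ x in Ioo 0 ℓ, (g x - c * η x) • f x
        = (∫ x in Ioo 0 ℓ, g x • f x) - c * a := by
      rw [ha, ← integral_const_mul, ← integral_sub (integrable_smul_intervalL2 f hg.continuous hgc)
        ((integrable_smul_intervalL2 f hη.continuous hηc).const_mul _)]
      refine integral_congr_ae (Eventually.of_forall fun x => ?_)
      simp only [Complex.real_smul]
      push_cast
      ring
    rw [h2, h3, ← h4, h1]
  have key := isOpen_Ioo.ae_eq_zero_of_integral_contDiff_smul_eq_zero (U := Ioo (0 : ℝ) ℓ)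
    (μ := volume.restrict (Ioo (0 : ℝ) ℓ))
    ((integrable_intervalL2 (f - a • oneL2 ℓ)).locallyIntegrable.locallyIntegrableOn _)
    hfin
  rw [← sub_eq_zero, Lp.eq_zero_iff_ae_eq_zero]
  filter_upwards [key, ae_restrict_mem measurableSet_Ioo] with x hx hm using hx hm

/-- The difference `f - V p` has weak derivative zero, hence is constant. Sobolev functions are
thereby encoded by an initial value and a derivative. -/
theorem hasWeakDeriv_iff (hℓ : 0 < ℓ) {f p : IntervalL2 ℓ} :
    HasWeakDeriv f p ↔ ∃ a : ℂ, f = a • oneL2 ℓ + volterra ℓ p := by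
  constructor
  · intro h
    have h0 := h.sub (hasWeakDeriv_volterra hℓ.le p)
    rw [sub_self] at h0
    obtain ⟨a, ha⟩ := h0.exists_eq_smul_oneL2 hℓ
    exact ⟨a, by rw [← ha, sub_add_cancel]⟩
  · rintro ⟨a, rfl⟩
    simpa using ((hasWeakDeriv_oneL2 hℓ.le).smul a).add (hasWeakDeriv_volterra hℓ.le p)

theorem coeFn_smul_oneL2_add_volterra (a : ℂ) (p : IntervalL2 ℓ) :
    (a • oneL2 ℓ + volterra ℓ p : IntervalL2 ℓ) =ᵐ[volume.restrict (Ioo 0 ℓ)]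
      fun x => a + primitive p x := by
  filter_upwards [Lp.coeFn_add (a • oneL2 ℓ) (volterra ℓ p), Lp.coeFn_smul a (oneL2 ℓ),
    coeFn_oneL2, coeFn_volterra p] with x h1 h2 h3 h4
  rw [h1, Pi.add_apply, h2, Pi.smul_apply, h3, h4, smul_eq_mul, mul_one]

theorem hasBoundaryValues_iff (hℓ : 0 < ℓ) {a b c : ℂ} {p : IntervalL2 ℓ} :
    HasBoundaryValues (a • oneL2 ℓ + volterra ℓ p) b c ↔ b = a ∧ c = a + ⟪oneL2 ℓ, p⟫_ℂ := by
  have hae := coeFn_smul_oneL2_add_volterra a p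
  have hcont : Continuous fun x => a + primitive p x :=
    continuous_const.add (continuous_primitive p)
  constructor
  · rintro ⟨u, hu, hfu, rfl, rfl⟩
    have hEq : EqOn u (fun x => a + primitive p x) (Ioo 0 ℓ) :=
      Measure.eqOn_open_of_ae_eq (hfu.symm.trans hae) isOpen_Ioo
        (hu.mono Ioo_subset_Icc_self) hcont.continuousOn
    have hcl : EqOn u (fun x => a + primitive p x) (Icc 0 ℓ) := by
      refine hEq.of_subset_closure hu hcont.continuousOn Ioo_subset_Icc_self ?_
      rw [closure_Ioo hℓ.ne]
    constructor
    · have := hcl (left_mem_Icc.2 hℓ.le)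
      simpa [primitive_of_nonpos] using this
    · have := hcl (right_mem_Icc.2 hℓ.le)
      simpa [primitive_of_le] using this
  · rintro ⟨rfl, rfl⟩
    refine ⟨_, hcont.continuousOn, hae, ?_, ?_⟩
    · simp [primitive_of_nonpos]
    · simp [primitive_of_le]

end WeakDerivative

/-! ### Constants, Green's formula and dimension on an interval -/

section IntervalLemmas

open scoped InnerProductSpace

variable {ℓ : ℝ}

theorem inner_oneL2_self (hℓ : 0 ≤ ℓ) : ⟪oneL2 ℓ, oneL2 ℓ⟫_ℂ = ℓ := by
  rw [inner_oneL2_left, integral_congr_ae coeFn_oneL2]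
  simp [hℓ]

theorem norm_smul_oneL2_sq (hℓ : 0 ≤ ℓ) (a : ℂ) : ‖a • oneL2 ℓ‖ ^ 2 = ℓ * ‖a‖ ^ 2 := by
  have h := inner_self_eq_norm_sq_to_K (𝕜 := ℂ) (oneL2 ℓ)
  rw [inner_oneL2_self hℓ] at h
  simp only [Complex.coe_algebraMap] at h
  have h' : ℓ = ‖oneL2 ℓ‖ ^ 2 := by exact_mod_cast h
  rw [norm_smul, mul_pow, ← h', mul_comm]

theorem inner_oneL2_sub_average (hℓ : 0 < ℓ) (q : IntervalL2 ℓ) :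
    ⟪oneL2 ℓ, q - (⟪oneL2 ℓ, q⟫_ℂ / ℓ) • oneL2 ℓ⟫_ℂ = 0 := by
  have : (ℓ : ℂ) ≠ 0 := by exact_mod_cast hℓ.ne'
  rw [inner_sub_right, inner_smul_right, inner_oneL2_self hℓ.le, div_mul_cancel₀ _ this, sub_self]

/-- A function orthogonal to all functions of vanishing mean is constant. -/
theorem exists_eq_smul_oneL2_of_inner_eq_zero (hℓ : 0 < ℓ) {z : IntervalL2 ℓ}
    (h : ∀ q : IntervalL2 ℓ, ⟪oneL2 ℓ, q⟫_ℂ = 0 → ⟪z, q⟫_ℂ = 0) : ∃ b : ℂ, z = b • oneL2 ℓ := by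
  refine ⟨⟪oneL2 ℓ, z⟫_ℂ / ℓ, ?_⟩
  have h1 := inner_oneL2_sub_average hℓ z
  have h2 := h _ h1
  rw [← sub_eq_zero, ← inner_self_eq_zero (𝕜 := ℂ), inner_sub_left, inner_smul_left, h1, h2]
  simp

/-- Green's formula on an interval. -/
theorem inner_add_inner_eq_boundary (a b : ℂ) (q r : IntervalL2 ℓ) :
    ⟪b • oneL2 ℓ + volterra ℓ r, q⟫_ℂ + ⟪r, a • oneL2 ℓ + volterra ℓ q⟫_ℂ
      = (starRingEnd ℂ) (b + ⟪oneL2 ℓ, r⟫_ℂ) * (a + ⟪oneL2 ℓ, q⟫_ℂ)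
        - (starRingEnd ℂ) b * a := by
  have h := inner_volterra_add r q
  rw [inner_add_left, inner_add_right, inner_smul_left, inner_smul_right, map_add,
    inner_conj_symm]
  linear_combination h

theorem volterra_injective (hℓ : 0 < ℓ) : Function.Injective (volterra ℓ) := by
  rw [injective_iff_map_eq_zero]
  intro q hq
  have h := hasWeakDeriv_volterra hℓ.le q
  rw [hq] at h
  exact h.eq_zero

/-- In finite dimension the injective operator `V` would be onto, so `1 = V q`; differentiating
gives `q = 0`, which is absurd. -/
theorem not_finiteDimensional_intervalL2 (hℓ : 0 < ℓ) : ¬ FiniteDimensional ℂ (IntervalL2 ℓ) := by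
  intro hfin
  have hsurj : Function.Surjective (volterra ℓ : IntervalL2 ℓ →ₗ[ℂ] IntervalL2 ℓ) :=
    LinearMap.injective_iff_surjective.1 (volterra_injective hℓ)
  obtain ⟨q, hq⟩ := hsurj (oneL2 ℓ)
  have hq' : volterra ℓ q = oneL2 ℓ := hq
  have h := (hasWeakDeriv_oneL2 hℓ.le).sub (hasWeakDeriv_volterra hℓ.le q)
  rw [hq', sub_self] at h
  have h0 := h.eq_zero
  rw [zero_sub, neg_eq_zero] at h0
  have h1 := inner_oneL2_self hℓ.le
  rw [← hq', h0, map_zero, inner_zero_left] at h1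
  exact hℓ.ne (by exact_mod_cast h1)

theorem IsCompactOperator.pi {ι M : Type*} {N : ι → Type*} [Finite ι] [Zero M] [TopologicalSpace M]
    [∀ i, TopologicalSpace (N i)] {f : ∀ i, M → N i} (hf : ∀ i, IsCompactOperator (f i)) :
    IsCompactOperator fun x i => f i x := by
  choose s hs hfs using hf
  refine ⟨univ.pi s, isCompact_univ_pi hs, ?_⟩
  have : (fun x i => f i x) ⁻¹' univ.pi s = ⋂ i, f i ⁻¹' s i := by
    ext x
    simp
  rw [this]
  exact Filter.iInter_mem.2 hfs

end IntervalLemmas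

/-! ### The Hilbert space `H¹(Γ)` and its compact embedding into `L²(Γ)` -/

namespace MetricGraph

open scoped InnerProductSpace

variable {V E : Type*} (Γ : MetricGraph V E)

/-- The edgewise Volterra operator. -/
def volterraL2 : Γ.L2 →L[ℂ] Γ.L2 :=
  (PiLp.continuousLinearEquiv 2 ℂ fun e => IntervalL2 (Γ.len e)).symm.toContinuousLinearMap ∘L
    ContinuousLinearMap.pi fun e => volterra (Γ.len e) ∘L PiLp.proj 2 _ e

@[simp]
theorem volterraL2_apply (p : Γ.L2) (e : E) : Γ.volterraL2 p e = volterra (Γ.len e) (p e) := rfl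

/-- The functions which are constant on each edge. -/
def edgeConst : (E → ℂ) →ₗ[ℂ] Γ.L2 where
  toFun a := WithLp.toLp 2 fun e => a e • oneL2 (Γ.len e)
  map_add' a b := by ext1 e; exact add_smul _ _ _
  map_smul' z a := by ext1 e; exact mul_smul _ _ _

@[simp]
theorem edgeConst_apply (a : E → ℂ) (e : E) : Γ.edgeConst a e = a e • oneL2 (Γ.len e) := rfl

/-- The functional `∫ p` on each edge. -/
def edgeIntegral : Γ.L2 →L[ℂ] (E → ℂ) :=
  ContinuousLinearMap.pi fun e => innerSL ℂ (oneL2 (Γ.len e)) ∘L PiLp.proj 2 _ e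

variable [Fintype E]

theorem isCompactOperator_volterraL2 : IsCompactOperator Γ.volterraL2 :=
  IsCompactOperator.clm_comp (f := fun (p : Γ.L2) e => volterra (Γ.len e) (p e))
    (IsCompactOperator.pi fun e =>
      isCompactOperator_volterra.comp_clm (PiLp.proj (𝕜 := ℂ) 2 (fun e => IntervalL2 (Γ.len e)) e))
    (PiLp.continuousLinearEquiv 2 ℂ fun e => IntervalL2 (Γ.len e)).symm.toContinuousLinearMap

/-- The values of an edgewise constant function, and the increments along the edges, prescribed by
values at the vertices. -/
def vertexData : (V → ℂ) →ₗ[ℂ] Γ.L2 × (E → ℂ) :=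
  (Γ.edgeConst ∘ₗ LinearMap.funLeft ℂ ℂ Γ.src).prod
    (LinearMap.funLeft ℂ ℂ Γ.tgt - LinearMap.funLeft ℂ ℂ Γ.src)

/-- The edgewise constant part and the increments along the edges of `f` with derivative `p`. -/
def sobolevData : WithLp 2 (Γ.L2 × Γ.L2) →L[ℂ] Γ.L2 × (E → ℂ) :=
  (WithLp.fstL 2 ℂ Γ.L2 Γ.L2 - Γ.volterraL2 ∘L WithLp.sndL 2 ℂ Γ.L2 Γ.L2).prod
    (Γ.edgeIntegral ∘L WithLp.sndL 2 ℂ Γ.L2 Γ.L2)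

/-- The Sobolev space `H¹(Γ)`, the domain of the quadratic form of the Laplacian, as the space of
the pairs of a function and its derivative. -/
def formDomain : Submodule ℂ (WithLp 2 (Γ.L2 × Γ.L2)) :=
  (LinearMap.range Γ.vertexData).comap (Γ.sobolevData : WithLp 2 (Γ.L2 × Γ.L2) →ₗ[ℂ] _)

theorem mem_formDomain {u : WithLp 2 (Γ.L2 × Γ.L2)} :
    u ∈ Γ.formDomain ↔ ∃ c : V → ℂ, ∀ e,
      u.fst e = c (Γ.src e) • oneL2 (Γ.len e) + volterra (Γ.len e) (u.snd e) ∧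
      c (Γ.tgt e) = c (Γ.src e) + ⟪oneL2 (Γ.len e), u.snd e⟫_ℂ := by
  have h : u ∈ Γ.formDomain ↔ ∃ c, Γ.vertexData c = Γ.sobolevData u := Iff.rfl
  rw [h]
  refine exists_congr fun c => ?_
  rw [Prod.ext_iff, forall_and]
  refine and_congr ?_ ?_
  · constructor
    · intro h e
      have h1 : c (Γ.src e) • oneL2 (Γ.len e) = u.fst e - volterra (Γ.len e) (u.snd e) :=
        congrArg (fun f : Γ.L2 => f e) h
      rw [h1, sub_add_cancel]
    · intro h
      ext1 e
      have : c (Γ.src e) • oneL2 (Γ.len e) = u.fst e - volterra (Γ.len e) (u.snd e) := by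
        rw [h e, add_sub_cancel_right]
      exact this
  · rw [funext_iff]
    refine forall_congr' fun e => ?_
    have : (Γ.vertexData c).2 e = (Γ.sobolevData u).2 e ↔
      c (Γ.tgt e) - c (Γ.src e) = ⟪oneL2 (Γ.len e), u.snd e⟫_ℂ := Iff.rfl
    rw [this, sub_eq_iff_eq_add']

/-- Continuity at the vertices puts finitely many scalar parameters into a finite-dimensional, hence
closed, range, and `sobolevData` is continuous. -/
theorem isClosed_formDomain [Finite V] : IsClosed (Γ.formDomain : Set (WithLp 2 (Γ.L2 × Γ.L2))) :=
  (LinearMap.range Γ.vertexData).closed_of_finiteDimensional.preimage Γ.sobolevData.continuous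

/-- The Hilbert space `H¹(Γ)`. -/
def FormSpace : Type _ := Γ.formDomain

instance : NormedAddCommGroup Γ.FormSpace := inferInstanceAs (NormedAddCommGroup Γ.formDomain)

instance : InnerProductSpace ℂ Γ.FormSpace := inferInstanceAs (InnerProductSpace ℂ Γ.formDomain)

instance [Finite V] : CompleteSpace Γ.FormSpace :=
  Γ.isClosed_formDomain.completeSpace_coe

/-- The inclusion of `H¹(Γ)` into the space of pairs. -/
def formInclusion : Γ.FormSpace →L[ℂ] WithLp 2 (Γ.L2 × Γ.L2) := Γ.formDomain.subtypeL

/-- The embedding of `H¹(Γ)` into `L²(Γ)`. -/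
def formEmbedding : Γ.FormSpace →L[ℂ] Γ.L2 :=
  WithLp.fstL 2 ℂ Γ.L2 Γ.L2 ∘L Γ.formInclusion

/-- The derivative as an operator from `H¹(Γ)` to `L²(Γ)`. -/
def formDeriv : Γ.FormSpace →L[ℂ] Γ.L2 :=
  WithLp.sndL 2 ℂ Γ.L2 Γ.L2 ∘L Γ.formInclusion

theorem formSpace_inner (u w : Γ.FormSpace) :
    ⟪u, w⟫_ℂ = ⟪Γ.formEmbedding u, Γ.formEmbedding w⟫_ℂ + ⟪Γ.formDeriv u, Γ.formDeriv w⟫_ℂ :=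
  rfl

theorem formSpace_norm_sq (u : Γ.FormSpace) :
    ‖u‖ ^ 2 = ‖Γ.formEmbedding u‖ ^ 2 + ‖Γ.formDeriv u‖ ^ 2 :=
  WithLp.prod_norm_sq_eq_of_L2 (Γ.formInclusion u)

theorem exists_vertexValues (u : Γ.FormSpace) : ∃ c : V → ℂ, ∀ e,
    Γ.formEmbedding u e = c (Γ.src e) • oneL2 (Γ.len e) + volterra (Γ.len e) (Γ.formDeriv u e) ∧
    c (Γ.tgt e) = c (Γ.src e) + ⟪oneL2 (Γ.len e), Γ.formDeriv u e⟫_ℂ :=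
  Γ.mem_formDomain.1 u.2

theorem exists_formSpace {f p : Γ.L2} {c : V → ℂ}
    (hf : ∀ e, f e = c (Γ.src e) • oneL2 (Γ.len e) + volterra (Γ.len e) (p e))
    (hc : ∀ e, c (Γ.tgt e) = c (Γ.src e) + ⟪oneL2 (Γ.len e), p e⟫_ℂ) :
    ∃ u : Γ.FormSpace, Γ.formEmbedding u = f ∧ Γ.formDeriv u = p :=
  ⟨⟨WithLp.toLp 2 (f, p), Γ.mem_formDomain.2 ⟨c, fun e => ⟨hf e, hc e⟩⟩⟩, rfl, rfl⟩

theorem formSpace_hasWeakDeriv (u : Γ.FormSpace) (e : E) :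
    HasWeakDeriv (Γ.formEmbedding u e) (Γ.formDeriv u e) := by
  obtain ⟨c, hc⟩ := Γ.exists_vertexValues u
  exact (hasWeakDeriv_iff (Γ.len_pos e)).2 ⟨_, (hc e).1⟩

theorem hasVertexValues_of_eq {u : Γ.FormSpace} {c : V → ℂ} (hc : ∀ e,
    Γ.formEmbedding u e = c (Γ.src e) • oneL2 (Γ.len e) + volterra (Γ.len e) (Γ.formDeriv u e) ∧
    c (Γ.tgt e) = c (Γ.src e) + ⟪oneL2 (Γ.len e), Γ.formDeriv u e⟫_ℂ) :
    Γ.HasVertexValues (Γ.formEmbedding u) c := by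
  intro e
  rw [(hc e).1]
  exact (hasBoundaryValues_iff (Γ.len_pos e)).2 ⟨rfl, (hc e).2⟩

theorem formEmbedding_injective : Function.Injective Γ.formEmbedding := by
  rw [injective_iff_map_eq_zero]
  intro u hu
  have hp : Γ.formDeriv u = 0 := by
    ext1 e
    have h := Γ.formSpace_hasWeakDeriv u e
    rw [hu] at h
    exact HasWeakDeriv.eq_zero h
  have h := Γ.formSpace_norm_sq u
  rw [hu, hp] at h
  simpa using h

theorem norm_formEmbedding_le (u : Γ.FormSpace) : ‖Γ.formEmbedding u‖ ≤ ‖u‖ := by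
  have h := Γ.formSpace_norm_sq u
  exact le_of_sq_le_sq (by nlinarith [sq_nonneg ‖Γ.formDeriv u‖]) (norm_nonneg _)

theorem isCompactOperator_formEmbedding : IsCompactOperator Γ.formEmbedding := by
  -- `A u e` averages the constant `f - V f'` over `e`, which recovers the value at the source. The
  -- embedding is thus a finite rank operator plus the compact operator `V` applied to the
  -- derivative.
  let A : Γ.FormSpace →L[ℂ] (E → ℂ) := ContinuousLinearMap.pi fun e =>
    ((Γ.len e : ℂ)⁻¹ • ContinuousLinearMap.proj e) ∘L Γ.edgeIntegral ∘L
      (Γ.formEmbedding - Γ.volterraL2 ∘L Γ.formDeriv)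
  have hA : Γ.formEmbedding = Γ.edgeConst.toContinuousLinearMap ∘L A
      + Γ.volterraL2 ∘L Γ.formDeriv := by
    ext1 u
    ext1 e
    obtain ⟨c, hc⟩ := Γ.exists_vertexValues u
    have hl : (Γ.len e : ℂ) ≠ 0 := by exact_mod_cast (Γ.len_pos e).ne'
    have h1 : A u e = c (Γ.src e) := by
      have : A u e = (Γ.len e : ℂ)⁻¹ * ⟪oneL2 (Γ.len e),
        Γ.formEmbedding u e - volterra (Γ.len e) (Γ.formDeriv u e)⟫_ℂ := rfl
      rw [this, (hc e).1, add_sub_cancel_right, inner_smul_right,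
        inner_oneL2_self (Γ.len_pos e).le]
      field_simp
    have h2 : (Γ.edgeConst.toContinuousLinearMap ∘L A + Γ.volterraL2 ∘L Γ.formDeriv) u e
      = A u e • oneL2 (Γ.len e) + volterra (Γ.len e) (Γ.formDeriv u e) := rfl
    rw [h2, h1, (hc e).1]
  rw [hA]
  exact ((isCompactOperator_of_locallyCompactSpace_rng
    Γ.edgeConst.toContinuousLinearMap).comp_clm A).add
    (Γ.isCompactOperator_volterraL2.comp_clm Γ.formDeriv)

theorem inner_single_right [DecidableEq E] (f : Γ.L2) (e : E) (q : IntervalL2 (Γ.len e)) :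
    ⟪f, PiLp.single 2 e q⟫_ℂ = ⟪f e, q⟫_ℂ := by
  rw [PiLp.inner_apply, Finset.sum_eq_single e, PiLp.single_eq_same]
  · intro e' _ he'
    rw [PiLp.single_eq_of_ne _ he', inner_zero_right]
  · exact fun h => absurd (Finset.mem_univ e) h

/-- Functions of `H¹(Γ)` supported in a single edge. -/
theorem exists_formSpace_single [DecidableEq E] (e : E) {q : IntervalL2 (Γ.len e)}
    (hq : ⟪oneL2 (Γ.len e), q⟫_ℂ = 0) : ∃ u : Γ.FormSpace,
      Γ.formEmbedding u = PiLp.single 2 e (volterra (Γ.len e) q) ∧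
      Γ.formDeriv u = PiLp.single 2 e q := by
  refine Γ.exists_formSpace (c := 0) (fun e' => ?_) (fun e' => ?_)
  · rw [Pi.zero_apply, zero_smul, zero_add]
    rcases eq_or_ne e' e with rfl | h
    · rw [PiLp.single_eq_same, PiLp.single_eq_same]
    · rw [PiLp.single_eq_of_ne _ h, PiLp.single_eq_of_ne _ h, map_zero]
  · rw [Pi.zero_apply, Pi.zero_apply, zero_add]
    rcases eq_or_ne e' e with rfl | h
    · rw [PiLp.single_eq_same, hq]
    · rw [PiLp.single_eq_of_ne _ h, inner_zero_right]

/-- Every mean-zero function on one edge is the derivative of an element of `H¹(Γ)`, and the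
constants add only one dimension. This guarantees that eigenvalues of every index exist. -/
theorem not_finiteDimensional_formSpace [Nonempty E] : ¬ FiniteDimensional ℂ Γ.FormSpace := by
  classical
  intro hfin
  obtain ⟨e⟩ := ‹Nonempty E›
  apply not_finiteDimensional_intervalL2 (Γ.len_pos e)
  let R : Γ.FormSpace →ₗ[ℂ] IntervalL2 (Γ.len e) :=
    (PiLp.proj 2 _ e ∘L Γ.formDeriv : Γ.FormSpace →L[ℂ] IntervalL2 (Γ.len e))
  have htop : Submodule.span ℂ {oneL2 (Γ.len e)} ⊔ LinearMap.range R = ⊤ := by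
    rw [eq_top_iff]
    intro q _
    obtain ⟨u, -, hu⟩ := Γ.exists_formSpace_single e (inner_oneL2_sub_average (Γ.len_pos e) q)
    refine Submodule.mem_sup.2 ⟨(⟪oneL2 (Γ.len e), q⟫_ℂ / Γ.len e) • oneL2 (Γ.len e),
      Submodule.smul_mem _ _ (Submodule.mem_span_singleton_self _), R u, ⟨u, rfl⟩, ?_⟩
    have : R u = q - (⟪oneL2 (Γ.len e), q⟫_ℂ / Γ.len e) • oneL2 (Γ.len e) := by
      change Γ.formDeriv u e = _
      rw [hu, PiLp.single_eq_same]
    rw [this, add_sub_cancel]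
  rw [FiniteDimensional, Module.finite_def, ← htop]
  exact (Submodule.fg_span_singleton _).sup
    (Module.Finite.iff_fg.1 (inferInstance : FiniteDimensional ℂ (LinearMap.range R)))

end MetricGraph

/-! ### Eigenfunctions as weak eigenvectors; min-max on the graph -/

namespace MetricGraph

open scoped InnerProductSpace

variable {V E : Type*} [Fintype E] (Γ : MetricGraph V E)

theorem mem_eigenspace_iff {μ : ℝ} {f : Γ.L2} :
    f ∈ Γ.eigenspace μ ↔ ∃ p : Γ.L2, (∀ e, HasWeakDeriv (f e) (p e)) ∧
      (∀ e, HasWeakDeriv (p e) (-((μ : ℂ) • f e))) ∧ (∃ c, Γ.HasVertexValues f c) ∧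
      Γ.Kirchhoff p := by
  have : f ∈ Γ.eigenspace μ ↔ (f, (μ : ℂ) • f) ∈ Γ.laplacian.graph := Iff.rfl
  rw [this, laplacian_graph]
  rfl

open Classical in
-- Regroup the edge sum by vertices; for the converse, test with the indicator of one vertex. The
-- right side is the boundary term of Green's formula.
theorem kirchhoff_sum_iff [Finite V] (a b : E → ℂ) :
    (∀ v, ∑ e with Γ.tgt e = v, b e - ∑ e with Γ.src e = v, a e = 0) ↔
      ∀ d : V → ℂ, ∑ e, ((starRingEnd ℂ) (b e) * d (Γ.tgt e)
        - (starRingEnd ℂ) (a e) * d (Γ.src e)) = 0 := by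
  have := Fintype.ofFinite V
  have hfib : ∀ (g : E → V) (b : E → ℂ) (d : V → ℂ),
      ∑ e, (starRingEnd ℂ) (b e) * d (g e)
        = ∑ v, (starRingEnd ℂ) (∑ e with g e = v, b e) * d v := by
    intro g b d
    rw [← Finset.sum_fiberwise Finset.univ g]
    refine Finset.sum_congr rfl fun v _ => ?_
    rw [map_sum, Finset.sum_mul]
    refine Finset.sum_congr rfl fun e he => ?_
    rw [(Finset.mem_filter.1 he).2]
  simp_rw [Finset.sum_sub_distrib, hfib, ← Finset.sum_sub_distrib, ← sub_mul, ← map_sub]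
  constructor
  · intro h d
    exact Finset.sum_eq_zero fun v _ => by rw [h v, map_zero, zero_mul]
  · intro h v
    have h1 := h (Pi.single v 1)
    rw [Finset.sum_eq_single v (fun w _ hw => by rw [Pi.single_eq_of_ne hw, mul_zero])
      fun h => absurd (Finset.mem_univ v) h, Pi.single_eq_same, mul_one] at h1
    exact (map_eq_zero _).1 h1

variable {Γ}

theorem isWeakEigenvector_formEmbedding_iff {μ : ℝ} {u : Γ.FormSpace} :
    IsWeakEigenvector Γ.formEmbedding μ u ↔ ∀ w : Γ.FormSpace,
      ⟪Γ.formDeriv u, Γ.formDeriv w⟫_ℂ = μ * ⟪Γ.formEmbedding u, Γ.formEmbedding w⟫_ℂ := by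
  refine forall_congr' fun w => ?_
  rw [formSpace_inner]
  push_cast
  constructor <;> intro h <;> linear_combination h

/-- Green's formula on the graph. -/
theorem inner_formDeriv_sub_eq_boundary {p r : Γ.L2} {b : E → ℂ}
    (hp : ∀ e, p e = b e • oneL2 (Γ.len e) + volterra (Γ.len e) (-(r e))) {w : Γ.FormSpace}
    {d : V → ℂ} (hd : ∀ e,
      Γ.formEmbedding w e = d (Γ.src e) • oneL2 (Γ.len e) + volterra (Γ.len e) (Γ.formDeriv w e) ∧
      d (Γ.tgt e) = d (Γ.src e) + ⟪oneL2 (Γ.len e), Γ.formDeriv w e⟫_ℂ) :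
    ⟪p, Γ.formDeriv w⟫_ℂ - ⟪r, Γ.formEmbedding w⟫_ℂ
      = ∑ e, ((starRingEnd ℂ) (b e + ⟪oneL2 (Γ.len e), -(r e)⟫_ℂ) * d (Γ.tgt e)
        - (starRingEnd ℂ) (b e) * d (Γ.src e)) := by
  rw [PiLp.inner_apply, PiLp.inner_apply, ← Finset.sum_sub_distrib]
  refine Finset.sum_congr rfl fun e _ => ?_
  rw [(hd e).2, ← inner_add_inner_eq_boundary, ← hp e, ← (hd e).1, inner_neg_left, sub_eq_add_neg]

variable (Γ) in
/-- The functions which are affine on each edge attain arbitrary values at the vertices. -/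
theorem exists_formSpace_of_vertexValues (d : V → ℂ) : ∃ w : Γ.FormSpace, ∀ e,
    Γ.formEmbedding w e = d (Γ.src e) • oneL2 (Γ.len e) + volterra (Γ.len e) (Γ.formDeriv w e) ∧
    d (Γ.tgt e) = d (Γ.src e) + ⟪oneL2 (Γ.len e), Γ.formDeriv w e⟫_ℂ := by
  have hl : ∀ e, (Γ.len e : ℂ) ≠ 0 := fun e => by exact_mod_cast (Γ.len_pos e).ne'
  set q : Γ.L2 := Γ.edgeConst fun e => (d (Γ.tgt e) - d (Γ.src e)) / Γ.len e with hqdef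
  have hq : ∀ e, d (Γ.tgt e) = d (Γ.src e) + ⟪oneL2 (Γ.len e), q e⟫_ℂ := by
    intro e
    rw [hqdef, edgeConst_apply, inner_smul_right, inner_oneL2_self (Γ.len_pos e).le,
      div_mul_cancel₀ _ (hl e), add_sub_cancel]
  obtain ⟨w, hw, hw'⟩ := Γ.exists_formSpace
    (f := Γ.edgeConst (fun e => d (Γ.src e)) + Γ.volterraL2 q)
    (fun e => by rw [PiLp.add_apply, edgeConst_apply, volterraL2_apply]) hq
  refine ⟨w, fun e => ?_⟩
  rw [hw, hw', PiLp.add_apply, edgeConst_apply, volterraL2_apply]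
  exact ⟨rfl, hq e⟩

/-- Green's formula, with the boundary term cancelled by the Kirchhoff condition and the continuity
of the test function. -/
theorem exists_isWeakEigenvector_of_mem_eigenspace [Finite V] {μ : ℝ} {f : Γ.L2}
    (hf : f ∈ Γ.eigenspace μ) :
    ∃ u : Γ.FormSpace, Γ.formEmbedding u = f ∧ IsWeakEigenvector Γ.formEmbedding μ u := by
  classical
  obtain ⟨p, h1, h2, ⟨c, hc⟩, α, β, hαβ, hK⟩ := Γ.mem_eigenspace_iff.1 hf
  have hfe : ∀ e, f e = c (Γ.src e) • oneL2 (Γ.len e) + volterra (Γ.len e) (p e) ∧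
      c (Γ.tgt e) = c (Γ.src e) + ⟪oneL2 (Γ.len e), p e⟫_ℂ := by
    intro e
    obtain ⟨a, ha⟩ := (hasWeakDeriv_iff (Γ.len_pos e)).1 (h1 e)
    have h3 := hc e
    rw [ha, hasBoundaryValues_iff (Γ.len_pos e)] at h3
    rw [ha, h3.1]
    exact ⟨rfl, h3.2⟩
  have hpe : ∀ e, p e = α e • oneL2 (Γ.len e) + volterra (Γ.len e) (-((μ : ℂ) • f) e) ∧
      β e = α e + ⟪oneL2 (Γ.len e), -((μ : ℂ) • f) e⟫_ℂ := by
    intro e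
    obtain ⟨a, ha⟩ := (hasWeakDeriv_iff (Γ.len_pos e)).1 (h2 e)
    have h3 := hαβ e
    rw [ha, hasBoundaryValues_iff (Γ.len_pos e)] at h3
    rw [ha, h3.1]
    exact ⟨rfl, h3.2⟩
  obtain ⟨u, hu, hu'⟩ := Γ.exists_formSpace (fun e => (hfe e).1) (fun e => (hfe e).2)
  refine ⟨u, hu, isWeakEigenvector_formEmbedding_iff.2 fun w => ?_⟩
  obtain ⟨d, hd⟩ := Γ.exists_vertexValues w
  have hG := inner_formDeriv_sub_eq_boundary (fun e => (hpe e).1) hd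
  have hB : ∀ e, α e + ⟪oneL2 (Γ.len e), -((μ : ℂ) • f) e⟫_ℂ = β e := fun e => (hpe e).2.symm
  simp_rw [hB] at hG
  rw [(Γ.kirchhoff_sum_iff α β).1 (fun v => by convert hK v) d, sub_eq_zero] at hG
  rw [hu, hu', hG, inner_smul_left, Complex.conj_ofReal]

/-- Test functions supported in one edge give the differential equation there; edgewise affine ones,
with arbitrary vertex values, then give the Kirchhoff condition. -/
theorem mem_eigenspace_of_isWeakEigenvector [Finite V] {μ : ℝ} {u : Γ.FormSpace}
    (hu : IsWeakEigenvector Γ.formEmbedding μ u) : Γ.formEmbedding u ∈ Γ.eigenspace μ := by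
  classical
  rw [isWeakEigenvector_formEmbedding_iff] at hu
  have hp : ∀ e, ∃ b : ℂ, Γ.formDeriv u e = b • oneL2 (Γ.len e)
      + volterra (Γ.len e) (-((μ : ℂ) • Γ.formEmbedding u) e) := by
    intro e
    -- Against mean-zero `q` the operator `V` is skew, so the weak equation makes `f' + μ V f`
    -- orthogonal to every such `q`.
    obtain ⟨b, hb⟩ := exists_eq_smul_oneL2_of_inner_eq_zero (Γ.len_pos e)
      (z := Γ.formDeriv u e - volterra (Γ.len e) (-((μ : ℂ) • Γ.formEmbedding u) e)) (by
        intro q hq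
        obtain ⟨w, hw, hw'⟩ := Γ.exists_formSpace_single e hq
        have h1 := hu w
        have h2 := inner_volterra_add (Γ.formEmbedding u e) q
        rw [hq, mul_zero] at h2
        rw [hw, hw', inner_single_right, inner_single_right] at h1
        rw [inner_sub_left, map_neg, PiLp.smul_apply, map_smul, inner_neg_left, inner_smul_left,
          Complex.conj_ofReal]
        linear_combination h1 + μ * h2)
    exact ⟨b, by rw [← hb, sub_add_cancel]⟩
  choose b hb using hp
  obtain ⟨c, hc⟩ := Γ.exists_vertexValues u
  refine Γ.mem_eigenspace_iff.2 ⟨Γ.formDeriv u, Γ.formSpace_hasWeakDeriv u,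
    fun e => (hasWeakDeriv_iff (Γ.len_pos e)).2 ⟨b e, hb e⟩, ⟨c, Γ.hasVertexValues_of_eq hc⟩,
    b, fun e => b e + ⟪oneL2 (Γ.len e), -((μ : ℂ) • Γ.formEmbedding u) e⟫_ℂ, fun e => ?_, ?_⟩
  · rw [hb e]
    exact (hasBoundaryValues_iff (Γ.len_pos e)).2 ⟨rfl, rfl⟩
  · have key : ∀ d : V → ℂ, ∑ e, ((starRingEnd ℂ)
        (b e + ⟪oneL2 (Γ.len e), -((μ : ℂ) • Γ.formEmbedding u) e⟫_ℂ) * d (Γ.tgt e)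
          - (starRingEnd ℂ) (b e) * d (Γ.src e)) = 0 := by
      intro d
      obtain ⟨w, hw⟩ := Γ.exists_formSpace_of_vertexValues d
      have hG := inner_formDeriv_sub_eq_boundary hb hw
      rw [hu w, inner_smul_left, Complex.conj_ofReal, sub_self] at hG
      exact hG.symm
    have hK := (Γ.kirchhoff_sum_iff b _).2 key
    intro v
    convert hK v

theorem nonneg_of_isWeakEigenvector {μ : ℝ} {u : Γ.FormSpace}
    (hu : IsWeakEigenvector Γ.formEmbedding μ u) (h0 : u ≠ 0) : 0 ≤ μ := by
  have h1 := hu.norm_sq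
  rw [Γ.formSpace_norm_sq] at h1
  have h2 : Γ.formEmbedding u ≠ 0 := fun h =>
    h0 (Γ.formEmbedding_injective (h.trans (map_zero _).symm))
  have h3 : 0 < ‖Γ.formEmbedding u‖ ^ 2 := by positivity
  by_contra hc
  nlinarith [sq_nonneg ‖Γ.formDeriv u‖]

theorem mem_eigenvalueBounds_iff [Finite V] {n : ℕ} {t : ℝ} :
    t ∈ Γ.eigenvalueBounds n ↔ ∃ w : Fin n → Γ.FormSpace, LinearIndependent ℂ w ∧
      ∀ i, ∃ ν ≤ t, IsWeakEigenvector Γ.formEmbedding ν (w i) := by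
  constructor
  · rintro ⟨f, hf, hμ⟩
    have h : ∀ i, ∃ u : Γ.FormSpace, Γ.formEmbedding u = f i ∧
        ∃ ν ≤ t, IsWeakEigenvector Γ.formEmbedding ν u := by
      intro i
      obtain ⟨μ, hμt, hμf⟩ := hμ i
      obtain ⟨u, hu, hu'⟩ := exists_isWeakEigenvector_of_mem_eigenspace hμf
      exact ⟨u, hu, μ, hμt, hu'⟩
    choose w hw hw' using h
    refine ⟨w, LinearIndependent.of_comp Γ.formEmbedding.toLinearMap ?_, hw'⟩
    convert hf
    exact funext hw
  · rintro ⟨w, hw, hν⟩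
    refine ⟨fun i => Γ.formEmbedding (w i), ?_, fun i => ?_⟩
    · exact hw.map' Γ.formEmbedding.toLinearMap
        (LinearMap.ker_eq_bot.2 Γ.formEmbedding_injective)
    · obtain ⟨ν, hνt, h⟩ := hν i
      exact ⟨ν, hνt, mem_eigenspace_of_isWeakEigenvector h⟩

variable (Γ) in
/-- The eigenvalues exist and are given by the min-max principle. -/
theorem isLeast_eigenvalue_and_minmax [Finite V] [Nonempty E] (n : ℕ) :
    IsLeast (Γ.eigenvalueBounds (n + 1)) (Γ.eigenvalue (n + 1)) ∧
      ∀ f : Fin (n + 1) → Γ.FormSpace, LinearIndependent ℂ f →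
        ∃ u ∈ Submodule.span ℂ (range f), u ≠ 0 ∧
          (1 + Γ.eigenvalue (n + 1)) * ‖Γ.formEmbedding u‖ ^ 2 ≤ ‖u‖ ^ 2 := by
  obtain ⟨μ, hμ, hmm⟩ := exists_minmax Γ.isCompactOperator_formEmbedding
    Γ.formEmbedding_injective Γ.norm_formEmbedding_le Γ.not_finiteDimensional_formSpace n
  have hleast : IsLeast (Γ.eigenvalueBounds (n + 1)) μ := by
    refine ⟨mem_eigenvalueBounds_iff.2 hμ, fun t ht => ?_⟩
    obtain ⟨w, hw, hν⟩ := mem_eigenvalueBounds_iff.1 ht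
    obtain ⟨u, hu, hu0, hle⟩ := hmm w hw
    have h1 := (norm_sq_le_of_mem_span hν hu).1
    have h2 : Γ.formEmbedding u ≠ 0 := fun h =>
      hu0 (Γ.formEmbedding_injective (h.trans (map_zero _).symm))
    have h3 := le_of_mul_le_mul_right (hle.trans h1) (by positivity)
    linarith
  have heq : Γ.eigenvalue (n + 1) = μ := hleast.csInf_eq
  rw [heq]
  exact ⟨hleast, hmm⟩

end MetricGraph

namespace MetricGraph

open scoped InnerProductSpace

/-! ### Positivity of the second eigenvalue -/

section Connected

variable {V E : Type*} {Γ : MetricGraph V E}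

theorem Connected.eq_of_forall_edge (hΓ : Γ.Connected) {c : V → ℂ}
    (hc : ∀ e, c (Γ.tgt e) = c (Γ.src e)) (v w : V) : c v = c w := by
  obtain ⟨p⟩ := hΓ.preconnected v w
  induction p with
  | nil => rfl
  | cons h _ ih =>
    rw [← ih]
    rw [underlyingGraph, SimpleGraph.fromRel_adj] at h
    obtain ⟨-, ⟨e, rfl, rfl⟩ | ⟨e, rfl, rfl⟩⟩ := h
    · exact (hc e).symm
    · exact hc e

end Connected

variable {V E : Type*} [Fintype E] {Γ : MetricGraph V E}

/-- On a connected graph, the second eigenvalue is positive. -/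
theorem Connected.pos_of_mem_eigenvalueBounds [Finite V] (hΓ : Γ.Connected) {n : ℕ} (hn : 2 ≤ n)
    {t : ℝ} (ht : t ∈ Γ.eigenvalueBounds n) : 0 < t := by
  obtain ⟨w, hw, hν⟩ := mem_eigenvalueBounds_iff.1 ht
  by_contra hcon
  -- If `t ≤ 0`, every eigenvalue involved is `0`, the derivatives vanish, and connectedness makes
  -- the eigenfunctions constant; two constants cannot be independent.
  have hconst : ∀ i, ∃ a : ℂ, Γ.formEmbedding (w i) = Γ.edgeConst fun _ => a := by
    intro i
    obtain ⟨ν, hνt, h⟩ := hν i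
    have h1 := nonneg_of_isWeakEigenvector h (hw.ne_zero i)
    have h2 : ν = 0 := by linarith
    have h3 := h.norm_sq
    rw [h2, Γ.formSpace_norm_sq, add_zero, one_mul, add_eq_left] at h3
    have hD : Γ.formDeriv (w i) = 0 := norm_eq_zero.1 (pow_eq_zero_iff two_ne_zero |>.1 h3)
    obtain ⟨c, hc⟩ := Γ.exists_vertexValues (w i)
    rw [hD] at hc
    obtain ⟨v⟩ := hΓ.nonempty
    have hcc := hΓ.eq_of_forall_edge (c := c) fun e => by
      have := (hc e).2
      rwa [PiLp.zero_apply, inner_zero_right, add_zero] at this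
    refine ⟨c v, ?_⟩
    ext1 e
    rw [(hc e).1, PiLp.zero_apply, map_zero, add_zero, hcc (Γ.src e) v, edgeConst_apply]
  let i₀ : Fin n := ⟨0, by omega⟩
  let i₁ : Fin n := ⟨1, by omega⟩
  have hne : i₀ ≠ i₁ := fun h => absurd (congrArg Fin.val h) (by simp [i₀, i₁])
  obtain ⟨a, ha⟩ := hconst i₀
  obtain ⟨b, hb⟩ := hconst i₁
  have hrel : b • w i₀ + (-a) • w i₁ = 0 := by
    apply Γ.formEmbedding_injective
    rw [map_add, map_smul, map_smul, ha, hb, map_zero, ← map_smul, ← map_smul, ← map_add]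
    have : (b • (fun _ : E => a) + (-a) • fun _ : E => b) = 0 := by
      ext e
      simp [mul_comm]
    rw [this, map_zero]
  have hli : LinearIndepOn ℂ w {i₀, i₁} := hw.comp Subtype.val Subtype.val_injective
  have hb0 := ((LinearIndepOn.pair_iff w hne).1 hli _ _ hrel).1
  have hw1 : w i₁ = 0 := by
    apply Γ.formEmbedding_injective
    rw [hb, hb0, map_zero]
    exact map_zero Γ.edgeConst
  exact hw.ne_zero i₁ hw1

/-! ### Constant extension along the pendant edge -/

section Pendant

variable [DecidableEq E] {e₀ : E} {v₀ v₁ : V} (h : Γ.IsPendant e₀ v₀ v₁)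

/-- Restriction of functions to the graph without the pendant edge. -/
def restrictL2 : Γ.L2 →ₗ[ℂ] (Γ.removePendant h).L2 where
  toFun f := WithLp.toLp 2 fun e => f e.1
  map_add' _ _ := rfl
  map_smul' _ _ := rfl

theorem norm_sq_eq_restrictL2 (f : Γ.L2) :
    ‖f‖ ^ 2 = ‖restrictL2 h f‖ ^ 2 + ‖f e₀‖ ^ 2 := by
  rw [PiLp.norm_sq_eq_of_L2, PiLp.norm_sq_eq_of_L2,
    Fintype.sum_eq_add_sum_subtype_ne (fun e => ‖f e‖ ^ 2) e₀, add_comm]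
  rfl

/-- `u` extends `u'` by a constant along the pendant edge. -/
structure IsPendantExtension (u : Γ.FormSpace) (u' : (Γ.removePendant h).FormSpace) : Prop where
  embedding : restrictL2 h (Γ.formEmbedding u) = (Γ.removePendant h).formEmbedding u'
  deriv : restrictL2 h (Γ.formDeriv u) = (Γ.removePendant h).formDeriv u'
  deriv_pendant : Γ.formDeriv u e₀ = 0

/-- Giving `v₁` the same value as `v₀` makes the increment along `e₀` zero, which matches the zero
derivative; no other edge meets `v₁`. -/
theorem exists_isPendantExtension (u' : (Γ.removePendant h).FormSpace) :
    ∃ u, IsPendantExtension h u u' := by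
  classical
  obtain ⟨c', hc'⟩ := (Γ.removePendant h).exists_vertexValues u'
  let c : V → ℂ := fun v => if hv : v = v₁ then c' ⟨v₀, h.ne⟩ else c' ⟨v, hv⟩
  have hcs : ∀ e : {e : E // e ≠ e₀}, c (Γ.src e) = c' ((Γ.removePendant h).src e) := fun e =>
    dif_neg ((Γ.removePendant h).src e).2
  have hct : ∀ e : {e : E // e ≠ e₀}, c (Γ.tgt e) = c' ((Γ.removePendant h).tgt e) := fun e =>
    dif_neg ((Γ.removePendant h).tgt e).2
  have hc0 : c (Γ.src e₀) = c (Γ.tgt e₀) := by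
    have h1 : c v₁ = c' ⟨v₀, h.ne⟩ := dif_pos rfl
    have h0 : c v₀ = c' ⟨v₀, h.ne⟩ := dif_neg h.ne
    rcases h.ends with ⟨hs, ht⟩ | ⟨hs, ht⟩
    · rw [hs, ht, h1, h0]
    · rw [hs, ht, h1, h0]
  let p : Γ.L2 := WithLp.toLp 2 fun e =>
    if he : e = e₀ then 0 else ((Γ.removePendant h).formDeriv u' ⟨e, he⟩ : IntervalL2 (Γ.len e))
  have hp0 : p e₀ = 0 := dif_pos rfl
  have hp : ∀ e : {e : E // e ≠ e₀}, p e = (Γ.removePendant h).formDeriv u' e := fun e =>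
    dif_neg e.2
  obtain ⟨u, hu, hu'⟩ := Γ.exists_formSpace (p := p) (c := c)
    (f := Γ.edgeConst (fun e => c (Γ.src e)) + Γ.volterraL2 p)
    (fun e => by rw [PiLp.add_apply, edgeConst_apply, volterraL2_apply]) (fun e => by
      rcases eq_or_ne e e₀ with rfl | he
      · rw [hp0, inner_zero_right, add_zero, hc0]
      · have h1 := (hc' ⟨e, he⟩).2
        rw [← hcs, ← hct, ← hp] at h1
        exact h1)
  refine ⟨u, ?_, ?_, ?_⟩
  · ext1 e
    have h1 := (hc' e).1
    rw [← hcs, ← hp] at h1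
    rw [hu, h1]
    rfl
  · ext1 e
    rw [hu', ← hp]
    rfl
  · rw [hu', hp0]

variable {h}

namespace IsPendantExtension

/-- The extension relation is linear in the pair, so extensions chosen separately for each basis
vector still match on linear combinations. -/
theorem exists_of_mem_span {ι : Type*} {U : ι → Γ.FormSpace}
    {U' : ι → (Γ.removePendant h).FormSpace} (hU : ∀ i, IsPendantExtension h (U i) (U' i))
    {u : Γ.FormSpace} (hu : u ∈ Submodule.span ℂ (range U)) :
    ∃ u' ∈ Submodule.span ℂ (range U'), IsPendantExtension h u u' := by
  induction hu using Submodule.span_induction with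
  | mem x hx =>
    obtain ⟨i, rfl⟩ := hx
    exact ⟨U' i, Submodule.subset_span ⟨i, rfl⟩, hU i⟩
  | zero =>
    exact ⟨0, Submodule.zero_mem _, by simp only [map_zero], by simp only [map_zero],
      by rw [map_zero, PiLp.zero_apply]⟩
  | add x y _ _ hx hy =>
    obtain ⟨x', hx', h1⟩ := hx
    obtain ⟨y', hy', h2⟩ := hy
    exact ⟨x' + y', Submodule.add_mem _ hx' hy',
      by simp only [map_add, h1.embedding, h2.embedding],
      by simp only [map_add, h1.deriv, h2.deriv],
      by rw [map_add, PiLp.add_apply, h1.deriv_pendant, h2.deriv_pendant, add_zero]⟩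
  | smul a x _ hx =>
    obtain ⟨x', hx', h1⟩ := hx
    exact ⟨a • x', Submodule.smul_mem _ _ hx', by simp only [map_smul, h1.embedding],
      by simp only [map_smul, h1.deriv],
      by rw [map_smul, PiLp.smul_apply, h1.deriv_pendant, smul_zero]⟩

theorem linearIndependent {ι : Type*} {U : ι → Γ.FormSpace}
    {U' : ι → (Γ.removePendant h).FormSpace} (hU : ∀ i, IsPendantExtension h (U i) (U' i))
    (hU' : LinearIndependent ℂ U') : LinearIndependent ℂ U := by
  refine LinearIndependent.of_comp (restrictL2 h ∘ₗ Γ.formEmbedding.toLinearMap) ?_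
  have h1 : (restrictL2 h ∘ₗ Γ.formEmbedding.toLinearMap) ∘ U
      = (Γ.removePendant h).formEmbedding.toLinearMap ∘ U' := funext fun i => (hU i).embedding
  rw [h1]
  exact hU'.map' _ (LinearMap.ker_eq_bot.2 (Γ.removePendant h).formEmbedding_injective)

variable {u : Γ.FormSpace} {u' : (Γ.removePendant h).FormSpace}

theorem norm_formEmbedding_sq (hu : IsPendantExtension h u u') :
    ‖Γ.formEmbedding u‖ ^ 2
      = ‖(Γ.removePendant h).formEmbedding u'‖ ^ 2 + ‖Γ.formEmbedding u e₀‖ ^ 2 := by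
  rw [norm_sq_eq_restrictL2 h, hu.embedding]

theorem norm_formDeriv_sq (hu : IsPendantExtension h u u') :
    ‖Γ.formDeriv u‖ ^ 2 = ‖(Γ.removePendant h).formDeriv u'‖ ^ 2 := by
  rw [norm_sq_eq_restrictL2 h, hu.deriv, hu.deriv_pendant, norm_zero]
  ring

/-- If the extension vanishes on the pendant edge, then the function is zero at `v₀`. -/
theorem exists_hasVertexValues (hu : IsPendantExtension h u u') (h0 : Γ.formEmbedding u e₀ = 0) :
    ∃ c, (Γ.removePendant h).HasVertexValues ((Γ.removePendant h).formEmbedding u') c ∧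
      c ⟨v₀, h.ne⟩ = 0 := by
  obtain ⟨c, hc⟩ := Γ.exists_vertexValues u
  refine ⟨fun v => c v, fun e => ?_, ?_⟩
  · rw [← hu.embedding]
    exact Γ.hasVertexValues_of_eq hc e
  · have h1 := hc e₀
    rw [h0, hu.deriv_pendant, map_zero, add_zero, inner_zero_right, add_zero] at h1
    have h2 : c (Γ.src e₀) = 0 := by
      have h3 := norm_smul_oneL2_sq (Γ.len_pos e₀).le (c (Γ.src e₀))
      rw [← h1.1, norm_zero] at h3
      have := (Γ.len_pos e₀).ne'
      simpa [this] using h3.symm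
    rcases h.ends with ⟨hs, -⟩ | ⟨-, ht⟩
    · exact (congrArg c hs).symm.trans h2
    · exact (congrArg c ht).symm.trans (h1.2.trans h2)

end IsPendantExtension

end Pendant

end MetricGraph

end

/-! ### Comparison of the eigenvalues -/

theorem proposition2p2 {V E : Type*} [Finite V] [Fintype E] [DecidableEq E]
    (Γ : MetricGraph V E) (hconn : Γ.Connected)
    (e₀ : E) (v₀ v₁ : V) (h : Γ.IsPendant e₀ v₀ v₁)
    (hE : 2 ≤ Fintype.card E) (k : ℕ) (hk : 1 ≤ k) :
    IsLeast (Γ.eigenvalueBounds (k + 1)) (Γ.eigenvalue (k + 1)) ∧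
    IsLeast ((Γ.removePendant h).eigenvalueBounds (k + 1))
      ((Γ.removePendant h).eigenvalue (k + 1)) ∧
    Γ.eigenvalue (k + 1) ≤ (Γ.removePendant h).eigenvalue (k + 1) ∧
    (Γ.eigenvalue (k + 1) = (Γ.removePendant h).eigenvalue (k + 1) →
      ∃ f ∈ (Γ.removePendant h).eigenspace ((Γ.removePendant h).eigenvalue (k + 1)),
        f ≠ 0 ∧ ∃ c, (Γ.removePendant h).HasVertexValues f c ∧ c ⟨v₀, h.ne⟩ = 0) := by
  have : Nontrivial E := Fintype.one_lt_card_iff_nontrivial.1 hE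
  have : Nonempty {e : E // e ≠ e₀} := nonempty_subtype.2 (exists_ne e₀)
  obtain ⟨hΓ, hmm⟩ := Γ.isLeast_eigenvalue_and_minmax k
  obtain ⟨hΓ', -⟩ := (Γ.removePendant h).isLeast_eigenvalue_and_minmax k
  refine ⟨hΓ, hΓ', ?_⟩
  obtain ⟨U', hU', hν⟩ := MetricGraph.mem_eigenvalueBounds_iff.1 hΓ'.1
  choose U hU using fun i => MetricGraph.exists_isPendantExtension h (U' i)
  obtain ⟨u, hu, hu0, hle⟩ := hmm U (MetricGraph.IsPendantExtension.linearIndependent hU hU')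
  obtain ⟨u', hu', hext⟩ := MetricGraph.IsPendantExtension.exists_of_mem_span hU hu
  obtain ⟨hle', heq'⟩ := norm_sq_le_of_mem_span hν hu'
  have hJ := hext.norm_formEmbedding_sq
  have hn := Γ.formSpace_norm_sq u
  have hn' := (Γ.removePendant h).formSpace_norm_sq u'
  rw [hext.norm_formDeriv_sq] at hn
  have hpos : 0 < Γ.eigenvalue (k + 1) := hconn.pos_of_mem_eigenvalueBounds (by omega) hΓ.1
  have hJu : 0 < ‖Γ.formEmbedding u‖ ^ 2 := by
    have : Γ.formEmbedding u ≠ 0 := fun h0 =>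
      hu0 (Γ.formEmbedding_injective (h0.trans (map_zero _).symm))
    positivity
  set μ := Γ.eigenvalue (k + 1)
  set μ' := (Γ.removePendant h).eigenvalue (k + 1)
  have hJu' : 0 ≤ ‖(Γ.removePendant h).formEmbedding u'‖ ^ 2 := sq_nonneg _
  have hJe : 0 ≤ ‖Γ.formEmbedding u e₀‖ ^ 2 := sq_nonneg _
  rw [hn, hJ] at hle
  rw [hn'] at hle'
  rw [hJ] at hJu
  -- `hle` and `hle'` combine to `μ ‖f‖²_{e₀} ≤ (μ' - μ) ‖f‖²_{Γ'}`. If `μ' < μ`, both norms vanish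
  -- because `μ > 0`, contradicting `hJu`.
  have hμ : μ ≤ μ' := by
    by_contra hcon
    push Not at hcon
    have h1 := mul_nonneg (sub_nonneg.2 hcon.le) hJu'
    have h2 : ‖Γ.formEmbedding u e₀‖ ^ 2 = 0 := by nlinarith
    nlinarith
  refine ⟨hμ, fun heq => ?_⟩
  rw [← heq] at hle' heq' ⊢
  have he : ‖Γ.formEmbedding u e₀‖ ^ 2 = 0 := by nlinarith
  have h0 : Γ.formEmbedding u e₀ = 0 := norm_eq_zero.1 (pow_eq_zero_iff two_ne_zero |>.1 he)
  -- With nothing on `e₀`, the min-max lower bound meets the upper bound on the span, so `u'` is in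
  -- the equality case.
  have hw := heq' (by rw [hn']; nlinarith)
  refine ⟨_, MetricGraph.mem_eigenspace_of_isWeakEigenvector hw, fun hz => ?_,
    hext.exists_hasVertexValues h0⟩
  rw [hz, he, norm_zero] at hJu
  simp at hJu
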